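/- Let $E/\mathbb{Q}$ be an elliptic curve, given as a projective plane curve by a Weierstrass equation $y^2z+a_1xyz+a_3yz^2=x^3+a_2x^2z+a_4xz^2+a_6z^3$ with integer coefficients and nonzero discriminant $\operatorname{disc}(E)$, the identity being $[0,1,0]$. Write points of $E(\mathbb{Q})$ as $[x,y,z]$ with $x,y,z\in\mathbb{Z}$ and $\gcd(x,y,z)=1$; such a point is called zero mod $N$ if $N\mid z$, and nonzero mod $N$ otherwise. Let $p$ be a prime, let $N$ be an odd positive integer prime to $p\operatorname{disc}(E)$, and let $P\in E(\mathbb{Q})$. Suppose that $b$ is a positive integer such that $p^b>(\sqrt{N/3}+1)^2$, that $p^bP$ is zero mod $N$, and that $p^{b-1}P$ is nonzero mod $N$. Then $N$ is prime. -/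

import Mathlib

namespace PrimeTest

/-- The projective points over `ℚ` of the curve defined by a Weierstrass equation with integer
coefficients, with Mathlib's group law (the identity is `[0, 1, 0]`). -/
abbrev RatPoint (E : WeierstrassCurve ℤ) : Type :=
  WeierstrassCurve.Projective.Point (E.map (Int.castRingHom ℚ)).toProjective

/-- `P = [x, y, z]` with `x, y, z ∈ ℤ` and `gcd (x, y, z) = 1`. -/
def IsPrimitiveRep {E : WeierstrassCurve ℤ} (P : RatPoint E) (x y z : ℤ) : Prop :=
  Int.gcd x (Int.gcd y z) = 1 ∧
    P.point = (⟦![(x : ℚ), (y : ℚ), (z : ℚ)]⟧ : WeierstrassCurve.Projective.PointClass ℚ)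

/-- `P = [x, y, z]`, written with coprime integer coordinates, is zero mod `N` if `N ∣ z`.
By `exists_isPrimitiveRep` and `IsPrimitiveRep.isZeroMod_iff` below, such coordinates exist and the
condition does not depend on their choice. -/
def IsZeroMod {E : WeierstrassCurve ℤ} (P : RatPoint E) (N : ℤ) : Prop :=
  ∃ x y z : ℤ, IsPrimitiveRep P x y z ∧ N ∣ z

/-- `P` is nonzero mod `N` if it is not zero mod `N`. -/
def IsNonzeroMod {E : WeierstrassCurve ℤ} (P : RatPoint E) (N : ℤ) : Prop :=
  ¬ IsZeroMod P N

theorem IsPrimitiveRep.isZeroMod_iff {E : WeierstrassCurve ℤ} {P : RatPoint E} {x y z : ℤ}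
    (h : IsPrimitiveRep P x y z) (N : ℤ) : IsZeroMod P N ↔ N ∣ z := by
  refine ⟨?_, fun hN => ⟨x, y, z, h, hN⟩⟩
  rintro ⟨x', y', z', h', hN⟩
  obtain ⟨u, hu⟩ := Quotient.exact (h.2.symm.trans h'.2)
  have hx : (u : ℚ) * x' = x := by simpa [Units.smul_def] using congrFun hu 0
  have hy : (u : ℚ) * y' = y := by simpa [Units.smul_def] using congrFun hu 1
  have hz : (u : ℚ) * z' = z := by simpa [Units.smul_def] using congrFun hu 2
  have e1 := Int.gcd_eq_gcd_ab x' (Int.gcd y' z')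
  rw [h'.1, Int.gcd_eq_gcd_ab y' z'] at e1
  set r := Int.gcdA x' (y' * Int.gcdA y' z' + z' * Int.gcdB y' z')
  set s := Int.gcdB x' (y' * Int.gcdA y' z' + z' * Int.gcdB y' z')
  have e2 : (1 : ℚ) = x' * r + (y' * Int.gcdA y' z' + z' * Int.gcdB y' z') * s := by
    exact_mod_cast e1
  have e3 : (u : ℚ) = x * r + (y * Int.gcdA y' z' + z * Int.gcdB y' z') * s := by
    rw [← hx, ← hy, ← hz]
    linear_combination (u : ℚ) * e2
  have e4 : (x * r + (y * Int.gcdA y' z' + z * Int.gcdB y' z') * s) * z' = z := by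
    rw [e3] at hz
    exact_mod_cast hz
  rw [← e4]
  exact Dvd.dvd.mul_left hN _

theorem exists_isPrimitiveRep {E : WeierstrassCurve ℤ} (P : RatPoint E) :
    ∃ x y z : ℤ, IsPrimitiveRep P x y z := by
  obtain ⟨v, hv⟩ := Quotient.exists_rep P.point
  have hns : WeierstrassCurve.Projective.Nonsingular
      (E.map (Int.castRingHom ℚ)).toProjective v := by
    have := P.nonsingular
    rw [← hv] at this
    exact this
  obtain ⟨d, hd, a, ha⟩ : ∃ d : ℚ, d ≠ 0 ∧ ∃ a : Fin 3 → ℤ, ∀ i, d * v i = a i := by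
    refine ⟨(v 0).den * (v 1).den * (v 2).den, by simp,
      ![(v 0).num * (v 1).den * (v 2).den, (v 0).den * (v 1).num * (v 2).den,
        (v 0).den * (v 1).den * (v 2).num], ?_⟩
    have h0 := Rat.mul_den_eq_num (v 0)
    have h1 := Rat.mul_den_eq_num (v 1)
    have h2 := Rat.mul_den_eq_num (v 2)
    intro i
    fin_cases i
    · change ((v 0).den * (v 1).den * (v 2).den : ℚ) * v 0 = (((v 0).num * (v 1).den * (v 2).den : ℤ) : ℚ)
      push_cast
      linear_combination ((v 1).den : ℚ) * (v 2).den * h0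
    · change ((v 0).den * (v 1).den * (v 2).den : ℚ) * v 1 = (((v 0).den * (v 1).num * (v 2).den : ℤ) : ℚ)
      push_cast
      linear_combination ((v 0).den : ℚ) * (v 2).den * h1
    · change ((v 0).den * (v 1).den * (v 2).den : ℚ) * v 2 = (((v 0).den * (v 1).den * (v 2).num : ℤ) : ℚ)
      push_cast
      linear_combination ((v 0).den : ℚ) * (v 1).den * h2
  set g : ℕ := Int.gcd (a 0) (Int.gcd (a 1) (a 2)) with hg
  have hg0 : g ≠ 0 := by
    intro h
    rw [hg, Int.gcd_eq_zero_iff] at h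
    obtain ⟨h0, h12⟩ := h
    have h12' : Int.gcd (a 1) (a 2) = 0 := by exact_mod_cast h12
    rw [Int.gcd_eq_zero_iff] at h12'
    have hv0 : ∀ i, v i = 0 := by
      intro i
      have := ha i
      have hai : a i = 0 := by fin_cases i <;> simp [h0, h12']
      rw [hai] at this
      simpa [hd] using this
    rw [WeierstrassCurve.Projective.nonsingular_iff] at hns
    simp [hv0] at hns
  have d0 : (g : ℤ) ∣ a 0 := Int.gcd_dvd_left ..
  have d12 : (g : ℤ) ∣ Int.gcd (a 1) (a 2) := Int.gcd_dvd_right ..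
  have d1 : (g : ℤ) ∣ a 1 := d12.trans (Int.gcd_dvd_left ..)
  have d2 : (g : ℤ) ∣ a 2 := d12.trans (Int.gcd_dvd_right ..)
  obtain ⟨x, hx⟩ := d0
  obtain ⟨y, hy⟩ := d1
  obtain ⟨z, hz⟩ := d2
  refine ⟨x, y, z, ?_, ?_⟩
  · rw [hx, hy, hz, Int.gcd_mul_left, Nat.cast_mul, Int.natAbs_natCast, Int.gcd_mul_left,
      Int.natAbs_natCast] at hg
    exact Nat.eq_of_mul_eq_mul_left (Nat.pos_of_ne_zero hg0) (by omega)
  · rw [← hv]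
    have hgq : (g : ℚ) ≠ 0 := by exact_mod_cast hg0
    have hu : IsUnit (d / g) := (div_ne_zero hd hgq).isUnit
    rw [← WeierstrassCurve.Projective.smul_eq v hu]
    congr 1
    have h0 := ha 0
    have h1 := ha 1
    have h2 := ha 2
    rw [hx] at h0
    rw [hy] at h1
    rw [hz] at h2
    push_cast at h0 h1 h2
    funext i
    fin_cases i
    · simp [div_mul_eq_mul_div, h0, hgq]
    · simp [div_mul_eq_mul_div, h1, hgq]
    · simp [div_mul_eq_mul_div, h2, hgq]

end PrimeTest

/-! If `N` does not divide the `z`-coordinate of `p^(b-1)P`, neither does some prime power `q^k`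
dividing `N`. The prime `q` is odd, different from `p` and of good reduction. On points that are
zero mod `q`, multiplication by `p`, a unit at `q`, does not raise the power of `q` dividing `z`
(`IsPrimitiveRep.pow_dvd_of_nsmul`). Since `q^k` divides the `z`-coordinate of `p^b P`, the point
`p^(b-1)P` is nonzero already mod `q`. So the reduction of `P` mod `q` has order exactly `p^b`, and
Hasse's bound gives `p^b ≤ (√q + 1)^2`. Hence `q > N/3`, and the odd number `N`, less than three
times its divisor `q`, equals `q`.

Reduction is carried out on `x`-coordinates alone: `x(P + Q)` and `x(P - Q)` are the roots of a
quadratic with coefficients polynomial in `x(P)` and `x(Q)`, so `x(nP)` obeys a two-step recursion.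
Cleared of denominators, it passes to residues mod `q` (`exists_reduction`), and near the identity
to residues mod powers of `q`, where it becomes linear (`IsIntRep.nsmul_near_zero`).

Hasse's upper bound (`card_point_le`) follows Manin. For `y² = f(x)`, the twist by `f` over `F_q(X)`
has a generic point `Q` (the identity map) and a Frobenius point. Let `D n` be the degree of the
`x`-coordinate of Frobenius plus `(n - 1)Q`. The same quadratic bounds the second differences of `D`
by 2; moreover `D 1 ≤ q`, and `D 0` exceeds the number of affine points, which are zeros of the
denominator. Nonnegativity of `D` then bounds the number of points. -/

namespace PrimeTest

open WeierstrassCurve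

/-! ### The quadratic satisfied by `x(P + Q)` and `x(P - Q)` -/

section XCoordinate

variable {R S : Type*} [CommRing R] [CommRing S] (W : WeierstrassCurve R)

/-- The square of the determinant of two vectors in homogeneous coordinates on the projective
line. -/
def diffSq (a₁ b₁ a₂ b₂ : R) : R := (a₁ * b₂ - a₂ * b₁) ^ 2

/-- The numerator of `x(P + Q) + x(P - Q)` in terms of `x(P) = a₁ / b₁` and `x(Q) = a₂ / b₂`, over
the denominator `diffSq a₁ b₁ a₂ b₂`. -/
def sumForm (a₁ b₁ a₂ b₂ : R) : R :=
  2 * (a₁ * a₂) * (a₁ * b₂ + a₂ * b₁) + W.b₂ * (a₁ * a₂) * (b₁ * b₂) +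
    W.b₄ * (b₁ * b₂) * (a₁ * b₂ + a₂ * b₁) + W.b₆ * (b₁ * b₂) ^ 2

/-- The numerator of `x(P + Q) * x(P - Q)` in terms of `x(P) = a₁ / b₁` and `x(Q) = a₂ / b₂`, over
the denominator `diffSq a₁ b₁ a₂ b₂`. -/
def prodForm (a₁ b₁ a₂ b₂ : R) : R :=
  (a₁ * a₂) ^ 2 - W.b₄ * (a₁ * a₂) * (b₁ * b₂) - W.b₆ * (b₁ * b₂) * (a₁ * b₂ + a₂ * b₁) -
    W.b₈ * (b₁ * b₂) ^ 2

lemma map_diffSq (φ : R →+* S) (a₁ b₁ a₂ b₂ : R) :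
    φ (diffSq a₁ b₁ a₂ b₂) = diffSq (φ a₁) (φ b₁) (φ a₂) (φ b₂) := by
  simp [diffSq]

lemma map_sumForm (φ : R →+* S) (a₁ b₁ a₂ b₂ : R) :
    φ (sumForm W a₁ b₁ a₂ b₂) = sumForm (W.map φ) (φ a₁) (φ b₁) (φ a₂) (φ b₂) := by
  simp only [sumForm, map_add, map_mul, map_pow, map_ofNat, map_b₂, map_b₄, map_b₆]

lemma map_prodForm (φ : R →+* S) (a₁ b₁ a₂ b₂ : R) :
    φ (prodForm W a₁ b₁ a₂ b₂) = prodForm (W.map φ) (φ a₁) (φ b₁) (φ a₂) (φ b₂) := by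
  simp only [prodForm, map_add, map_sub, map_mul, map_pow, map_b₄, map_b₆, map_b₈]

end XCoordinate

/-! ### Chord and tangent identities -/

section Identities

variable {R : Type*} [CommRing R] {a₁ a₂ a₃ a₄ a₆ x₁ y₁ x₂ y₂ : R}

/-- The chord formula makes the two brackets `(x₁ - x₂)²` times `x(P + Q)` and `x(P - Q)`; the
second has the `y`-coordinate of `-Q` in place of `y₂`. -/
lemma chord_sum_identity
    (e₁ : y₁ ^ 2 + a₁ * x₁ * y₁ + a₃ * y₁ = x₁ ^ 3 + a₂ * x₁ ^ 2 + a₄ * x₁ + a₆)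
    (e₂ : y₂ ^ 2 + a₁ * x₂ * y₂ + a₃ * y₂ = x₂ ^ 3 + a₂ * x₂ ^ 2 + a₄ * x₂ + a₆) :
    ((y₁ - y₂) ^ 2 + a₁ * (y₁ - y₂) * (x₁ - x₂) - (a₂ + x₁ + x₂) * (x₁ - x₂) ^ 2) +
      ((y₁ - (-y₂ - a₁ * x₂ - a₃)) ^ 2 + a₁ * (y₁ - (-y₂ - a₁ * x₂ - a₃)) * (x₁ - x₂) -
        (a₂ + x₁ + x₂) * (x₁ - x₂) ^ 2) =
    2 * (x₁ * x₂) * (x₁ + x₂) + (a₁ ^ 2 + 4 * a₂) * (x₁ * x₂) + (2 * a₄ + a₁ * a₃) * (x₁ + x₂) +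
      (a₃ ^ 2 + 4 * a₆) := by
  linear_combination 2 * e₁ + 2 * e₂

lemma chord_prod_identity
    (e₁ : y₁ ^ 2 + a₁ * x₁ * y₁ + a₃ * y₁ = x₁ ^ 3 + a₂ * x₁ ^ 2 + a₄ * x₁ + a₆)
    (e₂ : y₂ ^ 2 + a₁ * x₂ * y₂ + a₃ * y₂ = x₂ ^ 3 + a₂ * x₂ ^ 2 + a₄ * x₂ + a₆) :
    ((y₁ - y₂) ^ 2 + a₁ * (y₁ - y₂) * (x₁ - x₂) - (a₂ + x₁ + x₂) * (x₁ - x₂) ^ 2) *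
      ((y₁ - (-y₂ - a₁ * x₂ - a₃)) ^ 2 + a₁ * (y₁ - (-y₂ - a₁ * x₂ - a₃)) * (x₁ - x₂) -
        (a₂ + x₁ + x₂) * (x₁ - x₂) ^ 2) =
    (x₁ - x₂) ^ 2 * ((x₁ * x₂) ^ 2 - (2 * a₄ + a₁ * a₃) * (x₁ * x₂) -
      (a₃ ^ 2 + 4 * a₆) * (x₁ + x₂) -
      (a₁ ^ 2 * a₆ + 4 * a₂ * a₆ - a₁ * a₃ * a₄ + a₂ * a₃ ^ 2 - a₄ ^ 2)) := by
  grind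

lemma tangent_identity
    (e₁ : y₁ ^ 2 + a₁ * x₁ * y₁ + a₃ * y₁ = x₁ ^ 3 + a₂ * x₁ ^ 2 + a₄ * x₁ + a₆) :
    (3 * x₁ ^ 2 + 2 * a₂ * x₁ + a₄ - a₁ * y₁) ^ 2 +
      a₁ * (3 * x₁ ^ 2 + 2 * a₂ * x₁ + a₄ - a₁ * y₁) * (2 * y₁ + a₁ * x₁ + a₃) -
      (a₂ + 2 * x₁) * (2 * y₁ + a₁ * x₁ + a₃) ^ 2 =
    (x₁ ^ 2) ^ 2 - (2 * a₄ + a₁ * a₃) * (x₁ ^ 2) - (a₃ ^ 2 + 4 * a₆) * (2 * x₁) -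
      (a₁ ^ 2 * a₆ + 4 * a₂ * a₆ - a₁ * a₃ * a₄ + a₂ * a₃ ^ 2 - a₄ ^ 2) := by
  grind

end Identities

/-! ### Homogeneous `x`-coordinates over a field -/

section Field

variable {F : Type*} [Field F] {W : WeierstrassCurve F}

/-- `(a, b)` are homogeneous coordinates of the `x`-coordinate of `P`. -/
def IsXRep (P : W.toAffine.Point) (a b : F) : Prop :=
  ∃ c : F, c ≠ 0 ∧ a = c * P.xRep 0 ∧ b = c * P.xRep 1

lemma isXRep_zero_iff {a b : F} : IsXRep (0 : W.toAffine.Point) a b ↔ a ≠ 0 ∧ b = 0 := by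
  simp only [IsXRep, Affine.Point.xRep_zero]
  constructor
  · rintro ⟨c, hc, rfl, rfl⟩
    simpa using hc
  · rintro ⟨ha, rfl⟩
    exact ⟨a, ha, by simp, by simp⟩

lemma isXRep_some_iff {x y a b : F} (h : W.toAffine.Nonsingular x y) :
    IsXRep (.some x y h) a b ↔ b ≠ 0 ∧ a = x * b := by
  simp only [IsXRep, Affine.Point.xRep_some]
  constructor
  · rintro ⟨c, hc, rfl, rfl⟩
    simpa using ⟨hc, mul_comm _ _⟩
  · rintro ⟨hb, rfl⟩
    exact ⟨b, hb, by simp [mul_comm], by simp⟩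

lemma IsXRep.eq_zero_iff {P : W.toAffine.Point} {a b : F} (h : IsXRep P a b) : P = 0 ↔ b = 0 := by
  rcases P with _ | ⟨x, y, hP⟩
  · rw [← Affine.Point.zero_def] at h ⊢
    simp [(isXRep_zero_iff.mp h).2]
  · simp [Affine.Point.some_ne_zero, ((isXRep_some_iff hP).mp h).1]

lemma IsXRep.ne_zero {P : W.toAffine.Point} {a b : F} (h : IsXRep P a b) : a ≠ 0 ∨ b ≠ 0 := by
  rcases P with _ | ⟨x, y, hP⟩
  · exact .inl (isXRep_zero_iff.mp h).1
  · exact .inr ((isXRep_some_iff hP).mp h).1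

lemma IsXRep.smul {P : W.toAffine.Point} {a b u : F} (h : IsXRep P a b) (hu : u ≠ 0) :
    IsXRep P (u * a) (u * b) := by
  obtain ⟨c, hc, rfl, rfl⟩ := h
  exact ⟨u * c, mul_ne_zero hu hc, by ring, by ring⟩

lemma IsXRep.eq_smul {P : W.toAffine.Point} {a b a' b' : F} (h : IsXRep P a b)
    (h' : IsXRep P a' b') : ∃ u : F, u ≠ 0 ∧ a' = u * a ∧ b' = u * b := by
  obtain ⟨c, hc, rfl, rfl⟩ := h
  obtain ⟨c', hc', rfl, rfl⟩ := h'
  exact ⟨c' / c, div_ne_zero hc' hc, by field_simp, by field_simp⟩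

/-- In the symmetric functions of two points of the projective line, which do not all vanish, the
three forms are the coordinates of `addSubMap`, and this has no nontrivial zero when the
discriminant is nonzero. -/
lemma forms_ne_zero (hΔ : W.Δ ≠ 0) {a₁ b₁ a₂ b₂ : F} (h₁ : a₁ ≠ 0 ∨ b₁ ≠ 0)
    (h₂ : a₂ ≠ 0 ∨ b₂ ≠ 0) :
    ¬(diffSq a₁ b₁ a₂ b₂ = 0 ∧ sumForm W a₁ b₁ a₂ b₂ = 0 ∧ prodForm W a₁ b₁ a₂ b₂ = 0) := by
  rintro ⟨h, h', h''⟩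
  have : W.IsElliptic := ⟨hΔ.isUnit⟩
  refine W.addSubMap_ne_zero (x := ![a₁ * a₂, a₁ * b₂ + a₂ * b₁, b₁ * b₂]) ?_ ?_
  · intro h0
    have e0 := congrFun h0 0
    have e1 := congrFun h0 1
    have e2 := congrFun h0 2
    simp at e0 e1 e2
    grind
  · funext i
    fin_cases i
    · simp [addSubMap]
      rw [← h'', prodForm]
      ring
    · simp [addSubMap]
      rw [← h', sumForm]
      ring
    · simp [addSubMap]
      rw [← h, diffSq]
      ring

variable [DecidableEq F]

/-- This is the doubling case of `exists_xRep_add_sub`: there `P - Q = 0` has coordinates `(1, 0)`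
and `diffSq` vanishes, so two relations remain. It serves `Q = -P` as well. -/
lemma exists_xRep_add_self {x y : F} (h : W.toAffine.Nonsingular x y) : ∃ c : F,
    sumForm W x 1 x 1 = c * (Affine.Point.some x y h + .some x y h).xRep 1 ∧
    prodForm W x 1 x 1 = c * (Affine.Point.some x y h + .some x y h).xRep 0 := by
  have e := (Affine.equation_iff x y).mp h.1
  by_cases hy : y = W.toAffine.negY x y
  · rw [Affine.Point.add_self_of_Y_eq hy]
    -- Here `2P = 0` has coordinates `(1, 0)`, and `sumForm` vanishes because it equals `(2y + a₁x +
    -- a₃)²` on the curve.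
    refine ⟨prodForm W x 1 x 1, ?_, by simp⟩
    simp only [Affine.negY] at hy
    simp [sumForm, b₂, b₄, b₆]
    linear_combination (-4) * e + (2 * y + W.a₁ * x + W.a₃) * hy
  · rw [Affine.Point.add_self_of_Y_ne hy]
    have hd : y - W.toAffine.negY x y ≠ 0 := sub_ne_zero.mpr hy
    have hl : W.toAffine.slope x x y y * (2 * y + W.a₁ * x + W.a₃) =
        3 * x ^ 2 + 2 * W.a₂ * x + W.a₄ - W.a₁ * y := by
      rw [Affine.slope_of_Y_ne rfl hy,
        show 2 * y + W.a₁ * x + W.a₃ = y - W.toAffine.negY x y by rw [Affine.negY]; ring,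
        div_mul_cancel₀ _ hd]
    refine ⟨(2 * y + W.a₁ * x + W.a₃) ^ 2, ?_, ?_⟩
    · simp [sumForm, b₂, b₄, b₆]
      linear_combination (-4) * e
    · have ht := tangent_identity e
      rw [← hl] at ht
      simp [prodForm, Affine.addX, b₄, b₆, b₈]
      linear_combination -ht

lemma exists_xRep_add_sub (P Q : W.toAffine.Point) : ∃ c : F,
    diffSq (P.xRep 0) (P.xRep 1) (Q.xRep 0) (Q.xRep 1) =
      c * ((P + Q).xRep 1 * (P - Q).xRep 1) ∧
    sumForm W (P.xRep 0) (P.xRep 1) (Q.xRep 0) (Q.xRep 1) =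
      c * ((P + Q).xRep 0 * (P - Q).xRep 1 + (P + Q).xRep 1 * (P - Q).xRep 0) ∧
    prodForm W (P.xRep 0) (P.xRep 1) (Q.xRep 0) (Q.xRep 1) =
      c * ((P + Q).xRep 0 * (P - Q).xRep 0) := by
  rcases P with _ | ⟨x₁, y₁, h₁⟩
  · rw [← Affine.Point.zero_def, zero_add, zero_sub, Affine.Point.xRep_neg]
    refine ⟨1, ?_, ?_, ?_⟩ <;> simp [diffSq, sumForm, prodForm] <;> ring
  rcases Q with _ | ⟨x₂, y₂, h₂⟩
  · rw [← Affine.Point.zero_def, add_zero, sub_zero]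
    refine ⟨1, ?_, ?_, ?_⟩ <;> simp [diffSq, sumForm, prodForm] <;> ring
  have e₁ := (Affine.equation_iff x₁ y₁).mp h₁.1
  have e₂ := (Affine.equation_iff x₂ y₂).mp h₂.1
  by_cases hx : x₁ = x₂
  · subst hx
    obtain ⟨c, hs, hp⟩ := exists_xRep_add_self h₁
    rcases Affine.Y_eq_of_X_eq h₁.1 h₂.1 rfl with rfl | hy
    · rw [sub_self]
      refine ⟨c, ?_, ?_, ?_⟩
      · simp [diffSq]
      · simpa using hs
      · simpa using hp
    · have hn : Affine.Point.some x₁ y₁ h₁ = -Affine.Point.some x₁ y₂ h₂ := by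
        simp [hy]
      have hn' : Affine.Point.some x₁ y₂ h₂ = -Affine.Point.some x₁ y₁ h₁ := by
        rw [hn, neg_neg]
      rw [hn', add_neg_cancel, sub_neg_eq_add, Affine.Point.xRep_neg]
      refine ⟨c, ?_, ?_, ?_⟩
      · simp [diffSq]
      · simpa using hs
      · simpa using hp
  · have hd : x₁ - x₂ ≠ 0 := sub_ne_zero.mpr hx
    have hs := chord_sum_identity e₁ e₂
    have hp := chord_prod_identity e₁ e₂
    rw [sub_eq_add_neg, Affine.Point.neg_some, Affine.Point.add_of_X_ne hx,
      Affine.Point.add_of_X_ne hx, Affine.Point.xRep_some, Affine.Point.xRep_some,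
      Affine.Point.xRep_some, Affine.Point.xRep_some]
    have hl : W.toAffine.slope x₁ x₂ y₁ y₂ * (x₁ - x₂) = y₁ - y₂ := by
      rw [Affine.slope_of_X_ne hx, div_mul_cancel₀ _ hd]
    have hm : W.toAffine.slope x₁ x₂ y₁ (W.toAffine.negY x₂ y₂) * (x₁ - x₂) =
        y₁ - (-y₂ - W.a₁ * x₂ - W.a₃) := by
      rw [Affine.slope_of_X_ne hx, div_mul_cancel₀ _ hd, Affine.negY]
    generalize W.toAffine.slope x₁ x₂ y₁ y₂ = ℓ at hl ⊢
    generalize W.toAffine.slope x₁ x₂ y₁ (W.toAffine.negY x₂ y₂) = m at hm ⊢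
    refine ⟨(x₁ - x₂) ^ 2, ?_, ?_, ?_⟩
    · simp [diffSq]
    · rw [← hl, ← hm] at hs
      simp [sumForm, Affine.addX, b₂, b₄, b₆]
      linear_combination -hs
    · rw [← hl, ← hm] at hp
      apply mul_left_cancel₀ (pow_ne_zero 2 hd)
      simp [-mul_eq_mul_left_iff, prodForm, Affine.addX, b₄, b₆, b₈]
      linear_combination -hp

lemma IsXRep.exists_add_sub {P Q : W.toAffine.Point} {a₁ b₁ a₂ b₂ c d e f : F}
    (hP : IsXRep P a₁ b₁) (hQ : IsXRep Q a₂ b₂) (hs : IsXRep (P + Q) c d)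
    (hd : IsXRep (P - Q) e f) : ∃ r : F,
      diffSq a₁ b₁ a₂ b₂ = r * (d * f) ∧
      sumForm W a₁ b₁ a₂ b₂ = r * (c * f + d * e) ∧
      prodForm W a₁ b₁ a₂ b₂ = r * (c * e) := by
  obtain ⟨r, h₀, h₁, h₂⟩ := exists_xRep_add_sub P Q
  obtain ⟨s₁, hs₁, rfl, rfl⟩ := hP
  obtain ⟨s₂, hs₂, rfl, rfl⟩ := hQ
  obtain ⟨s₃, hs₃, rfl, rfl⟩ := hs
  obtain ⟨s₄, hs₄, rfl, rfl⟩ := hd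
  refine ⟨(s₁ * s₂) ^ 2 * r / (s₃ * s₄), ?_, ?_, ?_⟩
  · rw [diffSq] at h₀ ⊢
    field_simp
    linear_combination h₀
  · rw [sumForm] at h₁ ⊢
    field_simp
    linear_combination h₁
  · rw [prodForm] at h₂ ⊢
    field_simp
    linear_combination h₂

end Field
open Polynomial

/-! ### A Gauss lemma for products of two linear forms -/

section Coprime

variable {R : Type*} [CommRing R]

lemma exists_bezout_of_isCoprime {a₁ b₁ a₂ b₂ : R} (h₁ : IsCoprime a₁ b₁) (h₂ : IsCoprime a₂ b₂) :
    ∃ r s t : R, r * (b₁ * b₂) + s * (a₁ * b₂ + b₁ * a₂) + t * (a₁ * a₂) = 1 := by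
  obtain ⟨u₁, v₁, e₁⟩ := h₁
  obtain ⟨u₂, v₂, e₂⟩ := h₂
  set w := u₁ * v₂ - v₁ * u₂ with hw
  -- Put `α = a₁b₂`. Multiplying the two Bézout identities writes `1 - wα` in terms of the three
  -- products. Multiply by `1 + wα` and replace `α²` using `α² = α(a₁b₂ + b₁a₂) - (a₁a₂)(b₁b₂)`.
  refine ⟨v₁ * v₂ * (1 + w * (a₁ * b₂)), v₁ * u₂ * (1 + w * (a₁ * b₂)) + w ^ 2 * (a₁ * b₂),
    u₁ * u₂ * (1 + w * (a₁ * b₂)) - w ^ 2 * (b₁ * b₂), ?_⟩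
  have h : (u₁ * a₁ + v₁ * b₁) * (u₂ * a₂ + v₂ * b₂) = 1 := by rw [e₁, e₂, one_mul]
  rw [hw]
  linear_combination (1 + (u₁ * v₂ - v₁ * u₂) * (a₁ * b₂)) * h

end Coprime

/-! ### Degrees of maps to the projective line -/

section PairDegree

variable {k : Type*} [Field k]

/-- The degree of the morphism to the projective line with coprime homogeneous coordinates
`(A, B)`. -/
noncomputable def pairDegree (A B : k[X]) : ℕ := max A.natDegree B.natDegree

lemma coeff_pairDegree_ne_zero {A B : k[X]} (h : A ≠ 0 ∨ B ≠ 0) :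
    A.coeff (pairDegree A B) ≠ 0 ∨ B.coeff (pairDegree A B) ≠ 0 := by
  by_contra! hc
  rcases le_total A.natDegree B.natDegree with hle | hle
  · rw [pairDegree, max_eq_right hle, coeff_natDegree, leadingCoeff_eq_zero] at hc
    obtain ⟨h0, rfl⟩ := hc
    rw [natDegree_zero, Nat.le_zero] at hle
    rw [natDegree_zero, ← hle, coeff_natDegree, leadingCoeff_eq_zero] at h0
    simp [h0] at h
  · rw [pairDegree, max_eq_left hle, coeff_natDegree, leadingCoeff_eq_zero] at hc
    obtain ⟨rfl, h0⟩ := hc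
    rw [natDegree_zero, Nat.le_zero] at hle
    rw [natDegree_zero, ← hle, coeff_natDegree, leadingCoeff_eq_zero] at h0
    simp [h0] at h

/-- The coefficients in top degree form two nonzero vectors, and the product of two nonzero linear
forms is nonzero, so one of the three products attains the sum of the degrees. -/
lemma pairDegree_add_pairDegree_le {A₁ B₁ A₂ B₂ : k[X]} (h₁ : A₁ ≠ 0 ∨ B₁ ≠ 0)
    (h₂ : A₂ ≠ 0 ∨ B₂ ≠ 0) {N : ℕ} (hB : (B₁ * B₂).natDegree ≤ N)
    (hS : (A₁ * B₂ + B₁ * A₂).natDegree ≤ N) (hA : (A₁ * A₂).natDegree ≤ N) :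
    pairDegree A₁ B₁ + pairDegree A₂ B₂ ≤ N := by
  by_contra! hN
  have c₁ := coeff_pairDegree_ne_zero h₁
  have c₂ := coeff_pairDegree_ne_zero h₂
  have eB := coeff_eq_zero_of_natDegree_lt (hB.trans_lt hN)
  have eS := coeff_eq_zero_of_natDegree_lt (hS.trans_lt hN)
  have eA := coeff_eq_zero_of_natDegree_lt (hA.trans_lt hN)
  have lA₁ : A₁.natDegree ≤ pairDegree A₁ B₁ := le_max_left _ _
  have lB₁ : B₁.natDegree ≤ pairDegree A₁ B₁ := le_max_right _ _
  have lA₂ : A₂.natDegree ≤ pairDegree A₂ B₂ := le_max_left _ _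
  have lB₂ : B₂.natDegree ≤ pairDegree A₂ B₂ := le_max_right _ _
  rw [coeff_mul_add_eq_of_natDegree_le lB₁ lB₂] at eB
  rw [coeff_add, coeff_mul_add_eq_of_natDegree_le lA₁ lB₂, coeff_mul_add_eq_of_natDegree_le lB₁ lA₂] at eS
  rw [coeff_mul_add_eq_of_natDegree_le lA₁ lA₂] at eA
  grind

lemma natDegree_le_of_mul_eq {g A B : k[X]} (hg : g ≠ 0) (h : B = g * A) :
    A.natDegree ≤ B.natDegree := by
  rcases eq_or_ne A 0 with rfl | hA
  · simp
  · rw [h, natDegree_mul hg hA]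
    exact Nat.le_add_left _ _

end PairDegree

/-! ### The quadratic twist over the rational function field -/

section Twist

variable {k : Type*} [Field k] (a b c : k)

/-- The cubic polynomial `X ^ 3 + a X ^ 2 + b X + c`. -/
noncomputable def cubic : k[X] := X ^ 3 + C a * X ^ 2 + C b * X + C c

lemma cubic_eval (x : k) : (cubic a b c).eval x = x ^ 3 + a * x ^ 2 + b * x + c := by
  simp [cubic]

lemma cubic_natDegree : (cubic a b c).natDegree = 3 := by
  unfold cubic
  compute_degree!

lemma cubic_ne_zero : cubic a b c ≠ 0 := by
  intro h
  have := cubic_natDegree a b c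
  simp [h] at this

/-- The Weierstrass model, with coefficients in `k[X]`, of the quadratic twist of the curve
`y ^ 2 = cubic a b c` by the polynomial `cubic a b c`. -/
noncomputable def twistModel : WeierstrassCurve k[X] :=
  ⟨0, C a * cubic a b c, 0, C b * cubic a b c ^ 2, C c * cubic a b c ^ 3⟩

/-- The quadratic twist of the curve `y ^ 2 = cubic a b c` by `cubic a b c`. -/
noncomputable def twist : WeierstrassCurve (RatFunc k) :=
  (twistModel a b c).map (algebraMap k[X] (RatFunc k))

variable {a b c}

/-- `A` and `B` are coprime homogeneous coordinates of the `x`-coordinate of the point `P` of the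
twist, scaled so as to lie on the curve `y ^ 2 = cubic a b c`. -/
def IsTwistRep (P : (twist a b c).toAffine.Point) (A B : k[X]) : Prop :=
  IsCoprime A B ∧
    IsXRep P (algebraMap k[X] (RatFunc k) (cubic a b c * A)) (algebraMap k[X] (RatFunc k) B)

lemma IsTwistRep.ne_zero {P : (twist a b c).toAffine.Point} {A B : k[X]} (h : IsTwistRep P A B) :
    A ≠ 0 ∨ B ≠ 0 := by
  by_contra! h0
  have := h.2.ne_zero
  simp [h0] at this

lemma exists_isTwistRep (P : (twist a b c).toAffine.Point) : ∃ A B : k[X], IsTwistRep P A B := by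
  have hf : algebraMap k[X] (RatFunc k) (cubic a b c) ≠ 0 :=
    RatFunc.algebraMap_ne_zero (cubic_ne_zero a b c)
  rcases P with _ | ⟨x, y, h⟩
  · refine ⟨1, 0, isCoprime_one_left, ?_⟩
    rw [← Affine.Point.zero_def, isXRep_zero_iff]
    simpa using hf
  · set r := x / algebraMap k[X] (RatFunc k) (cubic a b c) with hr
    refine ⟨r.num, r.denom, r.isCoprime_num_denom, ?_⟩
    have hd := RatFunc.algebraMap_ne_zero r.denom_ne_zero
    rw [isXRep_some_iff]
    refine ⟨hd, ?_⟩
    have h1 := r.num_div_denom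
    rw [div_eq_iff hd] at h1
    rw [map_mul, h1, hr]
    field_simp

/-- The scalar relating the two pairs is a polynomial, by Bézout for the first. By symmetry the
degree depends only on `P`. -/
lemma IsTwistRep.pairDegree_le {P : (twist a b c).toAffine.Point} {A B A' B' : k[X]}
    (h : IsTwistRep P A B) (h' : IsTwistRep P A' B') : pairDegree A B ≤ pairDegree A' B' := by
  obtain ⟨u, hu, hA, hB⟩ := h.2.eq_smul h'.2
  obtain ⟨r, s, hrs⟩ := h.1
  have hf : algebraMap k[X] (RatFunc k) (cubic a b c) ≠ 0 :=
    RatFunc.algebraMap_ne_zero (cubic_ne_zero a b c)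
  have hA' : algebraMap k[X] (RatFunc k) A' = u * algebraMap k[X] (RatFunc k) A := by
    rw [map_mul, map_mul] at hA
    apply mul_left_cancel₀ hf
    linear_combination hA
  have hrs' := congrArg (algebraMap k[X] (RatFunc k)) hrs
  rw [map_add, map_mul, map_mul, map_one] at hrs'
  have hug : u = algebraMap k[X] (RatFunc k) (r * A' + s * B') := by
    rw [map_add, map_mul, map_mul, hA', hB]
    linear_combination (-u) * hrs'
  set g := r * A' + s * B'
  have hg : g ≠ 0 := by
    rintro h0
    simp [hug, h0] at hu
  rw [hug, ← map_mul] at hA' hB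
  exact max_le_max (natDegree_le_of_mul_eq hg (RatFunc.algebraMap_injective k hA'))
    (natDegree_le_of_mul_eq hg (RatFunc.algebraMap_injective k hB))

lemma twist_nonsingular (h2 : (2 : k) ≠ 0) {x y : k[X]} (hy : y ≠ 0)
    (h : y ^ 2 = x ^ 3 + C a * cubic a b c * x ^ 2 + C b * cubic a b c ^ 2 * x +
      C c * cubic a b c ^ 3) :
    (twist a b c).toAffine.Nonsingular (algebraMap k[X] (RatFunc k) x)
      (algebraMap k[X] (RatFunc k) y) := by
  have h2' : (2 : RatFunc k) ≠ 0 := by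
    have := RatFunc.algebraMap_ne_zero (C_ne_zero.mpr h2)
    rwa [map_ofNat, map_ofNat] at this
  rw [Affine.nonsingular_iff]
  constructor
  · rw [Affine.equation_iff]
    have h' := congrArg (algebraMap k[X] (RatFunc k)) h
    simp [twist, twistModel] at h' ⊢
    exact h'
  · right
    have hy' := RatFunc.algebraMap_ne_zero hy
    simp [twist, twistModel]
    intro h0
    apply mul_ne_zero h2' hy'
    linear_combination h0

/-- The point of the twist by `cubic a b c` over the generic point of the `x`-line. -/
noncomputable def genericPoint (a b c : k) (h2 : (2 : k) ≠ 0) : (twist a b c).toAffine.Point :=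
  -- With `f = cubic a b c`, this is the point `(X, 1)` of `f y² = x³ + a x² + b x + c`, carried to
  -- the Weierstrass model by `(x, y) ↦ (f x, f² y)`.
  .some _ _ (twist_nonsingular (x := cubic a b c * X) (y := cubic a b c ^ 2) h2
    (pow_ne_zero 2 (cubic_ne_zero a b c)) (by
      have h : cubic a b c = X ^ 3 + C a * X ^ 2 + C b * X + C c := rfl
      linear_combination cubic a b c ^ 3 * h))

-- The forms `U`, `V`, `T` in `A`, `B`, `X` have degree at most `2 * pairDegree A B + 2`, and they
-- are a nonzero polynomial multiple of the products of the coordinates of the sum and the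
-- difference. An inequality is enough, so the multiplier need not be shown constant.
open scoped Classical in
lemma pairDegree_add_sub_le (h2 : (2 : k) ≠ 0) {P : (twist a b c).toAffine.Point}
    {A B A₁ B₁ A₂ B₂ : k[X]} (h : IsTwistRep P A B)
    (h₁ : IsTwistRep (P + genericPoint a b c h2) A₁ B₁)
    (h₂ : IsTwistRep (P - genericPoint a b c h2) A₂ B₂) :
    pairDegree A₁ B₁ + pairDegree A₂ B₂ ≤ 2 * pairDegree A B + 2 := by
  set φ := algebraMap k[X] (RatFunc k) with hφ
  have hinj : Function.Injective φ := RatFunc.algebraMap_injective k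
  have hf : φ (cubic a b c) ≠ 0 := RatFunc.algebraMap_ne_zero (cubic_ne_zero a b c)
  have hQ : IsXRep (genericPoint a b c h2) (φ (cubic a b c * X)) (φ 1) := by
    rw [genericPoint, isXRep_some_iff, map_one, mul_one]
    exact ⟨one_ne_zero, rfl⟩
  obtain ⟨r, hU, hV, hW⟩ := h.2.exists_add_sub hQ h₁.2 h₂.2
  rw [← map_diffSq] at hU
  rw [twist, ← map_sumForm] at hV
  rw [twist, ← map_prodForm] at hW
  set U : k[X] := (A - X * B) ^ 2 with hUdef
  set V : k[X] := 2 * (A * X) * (A + X * B) + C (4 * a) * (A * X) * B +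
    C (2 * b) * B * (A + X * B) + C (4 * c) * B ^ 2 with hVdef
  set T : k[X] := (A * X) ^ 2 - C (2 * b) * (A * X) * B - C (4 * c) * B * (A + X * B) -
    C (4 * a * c - b ^ 2) * B ^ 2 with hTdef
  have eU : diffSq (cubic a b c * A) B (cubic a b c * X) 1 = cubic a b c ^ 2 * U := by
    rw [diffSq, hUdef]; ring
  have eV : sumForm (twistModel a b c) (cubic a b c * A) B (cubic a b c * X) 1 =
      cubic a b c ^ 3 * V := by
    simp only [sumForm, hVdef, twistModel, b₂, b₄, b₆, map_mul, map_ofNat]; ring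
  have eT : prodForm (twistModel a b c) (cubic a b c * A) B (cubic a b c * X) 1 =
      cubic a b c ^ 4 * T := by
    simp only [prodForm, hTdef, twistModel, b₄, b₆, b₈, map_mul, map_ofNat, map_sub, map_pow]; ring
  rw [eU] at hU
  rw [eV] at hV
  rw [eT] at hW
  clear_value U V T
  simp only [map_mul, map_pow] at hU hV hW
  -- The forms carry factors `f²`, `f³`, `f⁴` on the left and `1`, `f`, `f²` on the right, so this
  -- one normalisation removes `f` from all three.
  set w := r / φ (cubic a b c) ^ 2 with hw
  have hr : r = w * φ (cubic a b c) ^ 2 := by rw [hw]; field_simp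
  clear_value w
  rw [hr] at hU hV hW
  have hU' : φ U = w * φ (B₁ * B₂) := by
    apply mul_left_cancel₀ (pow_ne_zero 2 hf)
    rw [map_mul]; linear_combination hU
  have hV' : φ V = w * φ (A₁ * B₂ + B₁ * A₂) := by
    apply mul_left_cancel₀ (pow_ne_zero 3 hf)
    rw [map_add, map_mul, map_mul]; linear_combination hV
  have hT' : φ T = w * φ (A₁ * A₂) := by
    apply mul_left_cancel₀ (pow_ne_zero 4 hf)
    rw [map_mul]; linear_combination hW
  -- Since the three products generate the unit ideal, `w` is a polynomial.
  obtain ⟨x, y, z, hxyz⟩ := exists_bezout_of_isCoprime h₁.1 h₂.1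
  have hwg : w = φ (x * U + y * V + z * T) := by
    have := congrArg φ hxyz
    simp only [map_add, map_mul, map_one] at this hU' hV' hT' ⊢
    rw [hU', hV', hT']
    linear_combination (-w) * this
  set g := x * U + y * V + z * T
  rw [hwg, ← map_mul] at hU' hV' hT'
  have hU'' := hinj hU'
  have hV'' := hinj hV'
  have hT'' := hinj hT'
  -- Otherwise `U = V = 0`: the first gives `A = X * B`, and then the second reads `4 f B² = 0`, so
  -- `A` and `B` both vanish.
  have hg : g ≠ 0 := by
    intro h0
    rw [h0, zero_mul] at hU'' hV''
    have hAB : A = X * B := by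
      rw [hUdef] at hU''
      exact sub_eq_zero.mp (pow_eq_zero_iff two_ne_zero |>.mp hU'')
    have hVB : C 4 * cubic a b c * B ^ 2 = 0 := by
      rw [← hV'', hVdef, hAB, cubic]
      simp only [map_mul, map_ofNat]
      ring
    have h4 : (4 : k) ≠ 0 := by
      rw [show (4 : k) = 2 * 2 by norm_num]
      exact mul_ne_zero h2 h2
    have hB : B = 0 := by
      by_contra hB
      exact mul_ne_zero (mul_ne_zero (C_ne_zero.mpr h4) (cubic_ne_zero a b c))
        (pow_ne_zero 2 hB) hVB
    rcases h.ne_zero with h' | h'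
    · exact h' (by rw [hAB, hB, mul_zero])
    · exact h' hB
  set n := pairDegree A B
  have lA : A.natDegree ≤ n := le_max_left _ _
  have lB : B.natDegree ≤ n := le_max_right _ _
  have lAX : (A * X).natDegree ≤ n + 1 := natDegree_mul_le_of_le lA natDegree_X_le
  have lXB : (X * B).natDegree ≤ n + 1 := by
    rw [mul_comm]; exact natDegree_mul_le_of_le lB natDegree_X_le
  have lAXB : (A + X * B).natDegree ≤ n + 1 :=
    natDegree_add_le_of_degree_le (lA.trans (Nat.le_succ n)) lXB
  have lC (u : k) : (C u : k[X]).natDegree ≤ 0 := (natDegree_C u).le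
  have l2 : (2 : k[X]).natDegree ≤ 0 := by
    simp
  have lsub {m : ℕ} {p q : k[X]} (hp : p.natDegree ≤ m) (hq : q.natDegree ≤ m) :
      (p - q).natDegree ≤ m := (natDegree_sub_le_of_le hp hq).trans (max_self m).le
  apply pairDegree_add_pairDegree_le h₁.ne_zero h₂.ne_zero
  · refine (natDegree_le_of_mul_eq hg hU'').trans ?_
    rw [hUdef]
    exact (natDegree_pow_le_of_le 2 (lsub (lA.trans (Nat.le_succ n)) lXB)).trans (by omega)
  · refine (natDegree_le_of_mul_eq hg hV'').trans ?_
    rw [hVdef]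
    refine natDegree_add_le_of_degree_le (natDegree_add_le_of_degree_le
      (natDegree_add_le_of_degree_le ?_ ?_) ?_) ?_
    · exact (natDegree_mul_le_of_le (natDegree_mul_le_of_le l2 lAX) lAXB).trans (by omega)
    · exact (natDegree_mul_le_of_le (natDegree_mul_le_of_le (lC _) lAX) lB).trans (by omega)
    · exact (natDegree_mul_le_of_le (natDegree_mul_le_of_le (lC _) lB) lAXB).trans (by omega)
    · exact (natDegree_mul_le_of_le (lC _) (natDegree_pow_le_of_le 2 lB)).trans (by omega)
  · refine (natDegree_le_of_mul_eq hg hT'').trans ?_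
    rw [hTdef]
    refine lsub (lsub (lsub ?_ ?_) ?_) ?_
    · exact (natDegree_pow_le_of_le 2 lAX).trans (by omega)
    · exact (natDegree_mul_le_of_le (natDegree_mul_le_of_le (lC _) lAX) lB).trans (by omega)
    · exact (natDegree_mul_le_of_le (natDegree_mul_le_of_le (lC _) lB) lAXB).trans (by omega)
    · exact (natDegree_mul_le_of_le (lC _) (natDegree_pow_le_of_le 2 lB)).trans (by omega)

end Twist

/-! ### Nonnegative sequences with bounded second difference -/

section Arithmetic

/-- With `t = M - q - 1`, summing twice gives `D (n + 1) ≤ q - n t + n²`. Nonnegativity of `D` near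
the minimum `n = t / 2` yields the bound. -/
lemma sq_le_of_second_difference_le {D : ℕ → ℕ} {q M : ℕ} (hq : Odd q)
    (hD : ∀ n, D (n + 2) + D n ≤ 2 * D (n + 1) + 2) (h0 : M ≤ D 0) (h1 : D 1 ≤ q)
    (hM : q + 1 ≤ M) : (M - q - 1) ^ 2 ≤ 4 * q := by
  obtain ⟨t, rfl⟩ := Nat.exists_eq_add_of_le hM
  rw [show q + 1 + t - q - 1 = t by omega]
  have hdiff : ∀ n : ℕ, (D (n + 1) : ℤ) - D n ≤ 2 * n - t - 1 := by
    intro n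
    induction n with
    | zero => push_cast; omega
    | succ n ih =>
      have := hD n
      rw [show n + 1 + 1 = n + 2 from rfl]
      push_cast
      omega
  have hle : ∀ n : ℕ, (D (n + 1) : ℤ) ≤ q - n * t + n ^ 2 := by
    intro n
    induction n with
    | zero => simpa using h1
    | succ n ih =>
      have := hdiff (n + 1)
      push_cast at this ⊢
      linarith
  obtain ⟨s, hs | hs⟩ := Nat.even_or_odd' t
  · have := hle s
    rw [hs] at this ⊢
    push_cast at this
    zify
    nlinarith
  · have := hle s
    rw [hs] at this ⊢
    push_cast at this
    have h2 : s * (s + 1) ≤ q := by zify; nlinarith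
    -- For `t = 2s + 1` the weak bound `s(s + 1) ≤ q` only gives `t² ≤ 4q + 1`. As `s(s + 1)` is
    -- even and `q` odd, it is strict.
    have h3 : s * (s + 1) ≠ q := by
      intro h
      have := Nat.even_mul_succ_self s
      rw [h] at this
      exact (Nat.not_even_iff_odd.mpr hq) this
    have h4 : s * (s + 1) < q := lt_of_le_of_ne h2 h3
    nlinarith

end Arithmetic

/-! ### Frobenius and Hasse's upper bound -/

section Frobenius

variable {q : ℕ} [Fact q.Prime] (a b c : ZMod q)

lemma cubic_pow_card :
    cubic a b c ^ q = X ^ (3 * q) + C a * X ^ (2 * q) + C b * X ^ q + C c := by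
  rw [← ZMod.expand_card, cubic]
  simp only [map_add, map_mul, map_pow, expand_C, expand_X, ← pow_mul, mul_comm]

variable {a b c} {m : ℕ}

lemma two_ne_zero_of_eq (hm : q = 2 * m + 1) : (2 : ZMod q) ≠ 0 := by
  intro h
  have h' : ((2 : ℕ) : ZMod q) = 0 := by exact_mod_cast h
  rw [ZMod.natCast_eq_zero_iff] at h'
  have := Nat.le_of_dvd two_pos h'
  have := (Fact.out : q.Prime).two_le
  omega

/-- The point of the twist obtained from the generic point by the Frobenius endomorphism. -/
noncomputable def frobeniusPoint (a b c : ZMod q) (hm : q = 2 * m + 1) :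
    (twist a b c).toAffine.Point :=
  -- The `q`-th power map sends `(X, √f)` to `(X^q, √f · f^m)` with `m = (q - 1) / 2`; on `f y² = x³
  -- + a x² + b x + c` this is `(X^q, f^m)`, and the Weierstrass model multiplies its `y` by `f²`.
  .some _ _ (twist_nonsingular (x := cubic a b c * X ^ q) (y := cubic a b c ^ (m + 2))
    (two_ne_zero_of_eq hm) (pow_ne_zero _ (cubic_ne_zero a b c)) (by
      have h := cubic_pow_card a b c
      have h' : (cubic a b c ^ (m + 2)) ^ 2 = cubic a b c ^ 3 * cubic a b c ^ q := by
        rw [← pow_mul, ← pow_add]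
        congr 1
        omega
      rw [h', h]
      ring))

/-- The numerator of the `x`-coordinate of the difference of `frobeniusPoint` and
`genericPoint`. -/
noncomputable def frobeniusSubNum (a b c : ZMod q) (m : ℕ) : (ZMod q)[X] :=
  cubic a b c * (cubic a b c ^ m + 1) ^ 2 - (C a + X + X ^ q) * (X ^ q - X) ^ 2

lemma X_pow_sub_X_ne_zero : (X ^ q - X : (ZMod q)[X]) ≠ 0 :=
  FiniteField.X_pow_card_sub_X_ne_zero _ (Fact.out : q.Prime).one_lt

-- The chord formula gives `x / f = frobeniusSubNum / (X^q - X)²`, a fraction that need not be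
-- reduced; cancellation at the rational points is examined below.
open scoped Classical in
lemma isTwistRep_sub (hm : q = 2 * m + 1) {A B : (ZMod q)[X]}
    (h : IsTwistRep (frobeniusPoint a b c hm - genericPoint a b c (two_ne_zero_of_eq hm)) A B) :
    B ≠ 0 ∧ A * (X ^ q - X) ^ 2 = B * frobeniusSubNum a b c m := by
  set φ := algebraMap (ZMod q)[X] (RatFunc (ZMod q)) with hφ
  have hinj : Function.Injective φ := RatFunc.algebraMap_injective _
  have hf : φ (cubic a b c) ≠ 0 := RatFunc.algebraMap_ne_zero (cubic_ne_zero a b c)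
  have hd : φ (X ^ q - X) ≠ 0 := RatFunc.algebraMap_ne_zero X_pow_sub_X_ne_zero
  have hx : φ (cubic a b c * X ^ q) ≠ φ (cubic a b c * X) := by
    rw [← sub_ne_zero, ← map_sub, ← mul_sub, map_mul]
    exact mul_ne_zero hf hd
  have h2 := h.2
  rw [frobeniusPoint, genericPoint, sub_eq_add_neg, Affine.Point.neg_some,
    Affine.Point.add_of_X_ne hx, isXRep_some_iff] at h2
  obtain ⟨hB, hA⟩ := h2
  refine ⟨fun h0 ↦ hB (by rw [h0, map_zero]), hinj ?_⟩
  rw [Affine.slope_of_X_ne hx] at hA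
  simp only [Affine.addX, Affine.negY] at hA
  have e1 : (twist a b c).toAffine.a₁ = 0 := by simp [twist, twistModel]
  have e3 : (twist a b c).toAffine.a₃ = 0 := by simp [twist, twistModel]
  have e2 : (twist a b c).toAffine.a₂ = φ (C a) * φ (cubic a b c) := by
    simp [twist, twistModel, hφ]
  rw [e1, e2, e3, ← hφ] at hA
  rw [frobeniusSubNum]
  simp only [map_mul, map_add, map_sub, map_pow, map_one] at hA hd hf ⊢
  generalize φ (cubic a b c) = f at *
  generalize φ X = x at *
  generalize φ (C a) = a' at *
  rw [← mul_sub] at hA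
  field_simp at hA
  apply mul_left_cancel₀ (pow_ne_zero 3 hf)
  linear_combination hA

lemma dvd_of_eval_ne_zero {α : ZMod q} {n : ℕ} {A B : (ZMod q)[X]} (hn : n ≤ 2)
    (h : A * (X ^ q - X) ^ 2 = B * frobeniusSubNum a b c m)
    (hN : (frobeniusSubNum a b c m).eval α ≠ 0) : (X - C α) ^ n ∣ B := by
  have hα : (X - C α) ∣ (X ^ q - X : (ZMod q)[X]) := by
    rw [dvd_iff_isRoot]; simp [ZMod.pow_card]
  have h1 : (X - C α) ^ 2 ∣ B * frobeniusSubNum a b c m :=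
    h ▸ (pow_dvd_pow_of_dvd hα 2).mul_left A
  have h2 : IsCoprime (X - C α) (frobeniusSubNum a b c m) := by
    rw [(irreducible_X_sub_C α).coprime_iff_not_dvd, dvd_iff_isRoot]
    exact hN
  exact (pow_dvd_pow _ hn).trans (h2.pow_left.dvd_of_dvd_mul_right h1)

/-- A simple root of `f` is a simple zero of the numerator, so only one of the two factors `X - α`
of the denominator can cancel. -/
lemma dvd_of_eval_eq_zero {α : ZMod q} {A B : (ZMod q)[X]} (hm : 1 ≤ m)
    (h : A * (X ^ q - X) ^ 2 = B * frobeniusSubNum a b c m)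
    (h0 : (cubic a b c).eval α = 0) (h1 : 3 * α ^ 2 + 2 * a * α + b ≠ 0) : (X - C α) ∣ B := by
  have hα : (X - C α) ∣ (X ^ q - X : (ZMod q)[X]) := by
    rw [dvd_iff_isRoot]; simp [ZMod.pow_card]
  have hα2 := pow_dvd_pow_of_dvd hα 2
  have hd : (X - C α) ^ 2 ∣ B * frobeniusSubNum a b c m := h ▸ hα2.mul_left A
  by_contra hB
  have h2 : IsCoprime (X - C α) B := (irreducible_X_sub_C α).coprime_iff_not_dvd.mpr hB
  have h3 := h2.pow_left.dvd_of_dvd_mul_left hd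
  rw [frobeniusSubNum, dvd_sub_left (hα2.mul_left _)] at h3
  obtain ⟨g, hg⟩ := h3
  have h4 := congrArg (fun p ↦ (derivative p).eval α) hg
  have h5 : (derivative (cubic a b c)).eval α = 3 * α ^ 2 + 2 * a * α + b := by
    simp [cubic]; ring
  simp [derivative_mul, derivative_pow, h0, h5, zero_pow (Nat.one_le_iff_ne_zero.mp hm)] at h4
  exact h1 h4

/-- The terms in `X^(3q)` cancel because `f (f^m)² = f^q`, and what remains has leading term
`X^(2q+1)`. -/
lemma natDegree_frobeniusSubNum (hm : q = 2 * m + 1) (hm1 : 1 ≤ m) :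
    2 * q + 1 ≤ (frobeniusSubNum a b c m).natDegree := by
  have h2 : (2 : (ZMod q)[X]) = C 2 := (map_ofNat C 2).symm
  have key : frobeniusSubNum a b c m = X ^ (2 * q + 1) + (C a * X ^ (2 * q) + C b * X ^ q + C c +
      C 2 * cubic a b c ^ (m + 1) + cubic a b c - C a * (X ^ q - X) ^ 2 + X ^ (q + 2) - X ^ 3) := by
    have h := cubic_pow_card a b c
    have h' : cubic a b c ^ q = cubic a b c ^ (2 * m + 1) := by rw [← hm]
    rw [frobeniusSubNum, ← h2]
    linear_combination h - h'
  have hrem : (C a * X ^ (2 * q) + C b * X ^ q + C c + C 2 * cubic a b c ^ (m + 1) +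
      cubic a b c - C a * (X ^ q - X) ^ 2 + X ^ (q + 2) - X ^ 3 : (ZMod q)[X]).natDegree ≤
      2 * q := by
    have lsub {m : ℕ} {p r : (ZMod q)[X]} (hp : p.natDegree ≤ m) (hr : r.natDegree ≤ m) :
        (p - r).natDegree ≤ m := (natDegree_sub_le_of_le hp hr).trans (max_self m).le
    have ladd {m : ℕ} {p r : (ZMod q)[X]} (hp : p.natDegree ≤ m) (hr : r.natDegree ≤ m) :
        (p + r).natDegree ≤ m := natDegree_add_le_of_degree_le hp hr
    have lC (u : ZMod q) : (C u : (ZMod q)[X]).natDegree ≤ 0 := (natDegree_C u).le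
    have lX (n : ℕ) : (X ^ n : (ZMod q)[X]).natDegree ≤ n := natDegree_X_pow_le n
    have lf : (cubic a b c).natDegree ≤ 3 := (cubic_natDegree a b c).le
    refine lsub (ladd (lsub (ladd (ladd (ladd (ladd ?_ ?_) ?_) ?_) ?_) ?_) ?_) ?_
    · exact (natDegree_mul_le_of_le (lC _) (lX _)).trans (by omega)
    · exact (natDegree_mul_le_of_le (lC _) (lX _)).trans (by omega)
    · exact (lC _).trans (by omega)
    -- The inequality `3(m + 1) ≤ 2(2m + 1)` is where `1 ≤ m` is needed.
    · exact (natDegree_mul_le_of_le (lC _) (natDegree_pow_le_of_le (m + 1) lf)).trans (by omega)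
    · exact lf.trans (by omega)
    · have : (X ^ q - X : (ZMod q)[X]).natDegree ≤ q :=
        lsub (lX q) (natDegree_X_le.trans (by omega))
      exact (natDegree_mul_le_of_le (lC _) (natDegree_pow_le_of_le 2 this)).trans (by omega)
    · exact (lX _).trans (by omega)
    · exact (lX _).trans (by omega)
  apply le_natDegree_of_ne_zero
  rw [key, coeff_add, coeff_X_pow_self, coeff_eq_zero_of_natDegree_lt (Nat.lt_succ_of_le hrem)]
  simp

/-- The set of square roots of the value at `x` of `cubic a b c`. -/
def fiber (a b c x : ZMod q) : Finset (ZMod q) :=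
  Finset.univ.filter fun y ↦ y ^ 2 = x ^ 3 + a * x ^ 2 + b * x + c

lemma card_fiber_le_two (x : ZMod q) : (fiber a b c x).card ≤ 2 := by
  rcases (fiber a b c x).eq_empty_or_nonempty with h | ⟨y, hy⟩
  · simp [h]
  · refine (Finset.card_le_card (t := {y, -y}) ?_).trans Finset.card_le_two
    intro z hz
    simp only [fiber, Finset.mem_filter, Finset.mem_univ, true_and] at hy hz
    rw [← hy, sq_eq_sq_iff_eq_or_eq_neg] at hz
    simpa using hz

/-- Where `f(α)` is a nonzero square, `f(α)^m = 1` and the numerator takes the value `4 f(α) ≠ 0`,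
so both factors survive. At a root of `f` one survives, matching the single point. At a nonsquare
the fiber is empty. -/
lemma pow_card_fiber_dvd (hm : q = 2 * m + 1) (hm1 : 1 ≤ m)
    (hsep : ∀ x : ZMod q, x ^ 3 + a * x ^ 2 + b * x + c = 0 → 3 * x ^ 2 + 2 * a * x + b ≠ 0)
    {A B : (ZMod q)[X]} (h : A * (X ^ q - X) ^ 2 = B * frobeniusSubNum a b c m) (α : ZMod q) :
    (X - C α) ^ (fiber a b c α).card ∣ B := by
  by_cases h0 : α ^ 3 + a * α ^ 2 + b * α + c = 0
  · have h1 : (fiber a b c α).card ≤ 1 := by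
      rw [Finset.card_le_one]
      intro y hy z hz
      simp only [fiber, Finset.mem_filter, Finset.mem_univ, true_and, h0] at hy hz
      rw [pow_eq_zero_iff two_ne_zero] at hy hz
      rw [hy, hz]
    refine (pow_dvd_pow _ h1).trans ?_
    rw [pow_one]
    exact dvd_of_eval_eq_zero hm1 h (by rw [cubic_eval, h0]) (hsep α h0)
  · rcases (fiber a b c α).eq_empty_or_nonempty with he | ⟨y, hy⟩
    · simp [he]
    · apply dvd_of_eval_ne_zero (card_fiber_le_two α) h
      simp only [fiber, Finset.mem_filter, Finset.mem_univ, true_and] at hy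
      have hy0 : y ≠ 0 := by
        rintro rfl
        exact h0 (by rw [← hy]; simp)
      have hs : (α ^ 3 + a * α ^ 2 + b * α + c) ^ m = 1 := by
        rw [← hy, ← pow_mul, show 2 * m = q - 1 by omega]
        exact ZMod.pow_card_sub_one_eq_one hy0
      simp only [frobeniusSubNum, eval_sub, eval_mul, eval_pow, eval_add, eval_X, eval_C, eval_one,
        cubic_eval, hs, ZMod.pow_card, sub_self]
      have h2 := two_ne_zero_of_eq hm
      simp only [ne_eq, OfNat.ofNat_ne_zero, not_false_eq_true, zero_pow, mul_zero, sub_zero]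
      rw [show (1 + 1 : ZMod q) = 2 by norm_num]
      exact mul_ne_zero h0 (pow_ne_zero 2 h2)

lemma sum_card_fiber_le_natDegree (hm : q = 2 * m + 1) (hm1 : 1 ≤ m)
    (hsep : ∀ x : ZMod q, x ^ 3 + a * x ^ 2 + b * x + c = 0 → 3 * x ^ 2 + 2 * a * x + b ≠ 0)
    {A B : (ZMod q)[X]} (hB : B ≠ 0) (h : A * (X ^ q - X) ^ 2 = B * frobeniusSubNum a b c m) :
    ∑ x, (fiber a b c x).card ≤ B.natDegree := by
  have hdvd : ∏ x : ZMod q, (X - C x) ^ (fiber a b c x).card ∣ B := by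
    apply Finset.prod_dvd_of_coprime
    · intro x _ y _ hxy
      exact (pairwise_coprime_X_sub_C Function.injective_id hxy).pow
    · exact fun x _ ↦ pow_card_fiber_dvd hm hm1 hsep h x
  refine le_trans (le_of_eq ?_) (natDegree_le_of_dvd hdvd hB)
  rw [natDegree_prod_of_monic _ _ fun x _ ↦ (monic_X_sub_C x).pow _]
  simp

open scoped Classical in
theorem card_affine_points_le (hq2 : q ≠ 2)
    (hsep : ∀ x : ZMod q, x ^ 3 + a * x ^ 2 + b * x + c = 0 → 3 * x ^ 2 + 2 * a * x + b ≠ 0)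
    (hM : q ≤ ∑ x, (fiber a b c x).card) :
    (∑ x, (fiber a b c x).card - q) ^ 2 ≤ 4 * q := by
  have hp : q.Prime := Fact.out
  obtain ⟨m, hm⟩ := hp.odd_of_ne_two hq2
  have hm1 : 1 ≤ m := by have := hp.two_le; omega
  set Q := genericPoint a b c (two_ne_zero_of_eq hm) with hQ
  set P : ℕ → (twist a b c).toAffine.Point := fun n ↦ (frobeniusPoint a b c hm - Q) + n • Q
    with hP
  choose A B hAB using fun n ↦ exists_isTwistRep (P n)
  have hD : ∀ n, pairDegree (A (n + 2)) (B (n + 2)) + pairDegree (A n) (B n) ≤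
      2 * pairDegree (A (n + 1)) (B (n + 1)) + 2 := by
    intro n
    apply pairDegree_add_sub_le (two_ne_zero_of_eq hm) (hAB (n + 1))
    · convert hAB (n + 2) using 1
      simp only [hP, ← hQ]
      module
    · convert hAB n using 1
      simp only [hP, ← hQ]
      module
  have h1 : pairDegree (A 1) (B 1) ≤ q := by
    have hrep : IsTwistRep (P 1) (X ^ q) 1 := by
      refine ⟨isCoprime_one_right, ?_⟩
      rw [hP]
      simp only [one_smul, sub_add_cancel]
      rw [frobeniusPoint, isXRep_some_iff]
      simp
    refine ((hAB 1).pairDegree_le hrep).trans ?_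
    simp [pairDegree]
  have h0 : ∑ x, (fiber a b c x).card + 1 ≤ pairDegree (A 0) (B 0) := by
    have hr := hAB 0
    simp only [hP, zero_nsmul, add_zero] at hr
    obtain ⟨hB, he⟩ := isTwistRep_sub hm hr
    have hle := sum_card_fiber_le_natDegree hm hm1 hsep hB he
    have hN := natDegree_frobeniusSubNum (a := a) (b := b) (c := c) hm hm1
    have hN0 : frobeniusSubNum a b c m ≠ 0 := by
      intro h; rw [h] at hN; simp at hN
    have hA0 : A 0 ≠ 0 := by
      intro h
      rw [h, zero_mul] at he
      exact mul_ne_zero hB hN0 he.symm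
    -- The numerator has degree at least `2q + 1` and the denominator `2q`, so `A 0` has larger
    -- degree than `B 0`; this extra one accounts for the point at infinity.
    have hdeg := congrArg natDegree he
    rw [natDegree_mul hA0 (pow_ne_zero 2 X_pow_sub_X_ne_zero), natDegree_mul hB hN0,
      natDegree_pow, FiniteField.X_pow_card_sub_X_natDegree_eq _ hp.one_lt] at hdeg
    refine le_trans ?_ (le_max_left _ _)
    omega
  refine le_trans (le_of_eq ?_) (sq_le_of_second_difference_le
    (D := fun n ↦ pairDegree (A n) (B n)) ⟨m, hm⟩ hD h0 h1 (by omega))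
  congr 1
  omega

variable (W : WeierstrassCurve (ZMod q))

/-- The affine points of a Weierstrass curve in odd characteristic, after completing the square. -/
def toFiber (hq2 : (2 : ZMod q) ≠ 0) :
    W.toAffine.Point → Option (Σ x, fiber (W.b₂ / 4) (W.b₄ / 2) (W.b₆ / 4) x)
  | .zero => none
  | .some x y h => some ⟨x, y + (W.a₁ * x + W.a₃) / 2, by
      have h4 : (4 : ZMod q) ≠ 0 := by
        rw [show (4 : ZMod q) = 2 * 2 by norm_num]
        exact mul_ne_zero hq2 hq2
      have e := (Affine.equation_iff x y).mp h.1
      rw [fiber, Finset.mem_filter]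
      refine ⟨Finset.mem_univ _, ?_⟩
      simp only [b₂, b₄, b₆]
      field_simp
      linear_combination 16 * e⟩

lemma toFiber_injective (hq2 : (2 : ZMod q) ≠ 0) : Function.Injective (toFiber W hq2) := by
  rintro (_ | ⟨x, y, h⟩) (_ | ⟨x', y', h'⟩) he
  · rfl
  · simp [toFiber] at he
  · simp [toFiber] at he
  · simp only [toFiber, Option.some.injEq, Sigma.mk.injEq] at he
    obtain ⟨rfl, he⟩ := he
    simp only [heq_eq_eq, Subtype.mk.injEq, add_left_inj] at he
    subst he
    rfl

/-- A multiple root would be the `x`-coordinate of a singular point of `W`, with `2y + a₁x + a₃ =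
0`. -/
lemma cubic_separable {W : WeierstrassCurve (ZMod q)} (hq2 : (2 : ZMod q) ≠ 0) (hΔ : W.Δ ≠ 0)
    (x : ZMod q) (h : x ^ 3 + W.b₂ / 4 * x ^ 2 + W.b₄ / 2 * x + W.b₆ / 4 = 0) :
    3 * x ^ 2 + 2 * (W.b₂ / 4) * x + W.b₄ / 2 ≠ 0 := by
  intro h'
  have h4 : (4 : ZMod q) ≠ 0 := by
    rw [show (4 : ZMod q) = 2 * 2 by norm_num]
    exact mul_ne_zero hq2 hq2
  have heq : W.toAffine.Equation x (-(W.a₁ * x + W.a₃) / 2) := by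
    rw [Affine.equation_iff]
    simp only [b₂, b₄, b₆] at h
    field_simp at h ⊢
    apply mul_left_cancel₀ hq2
    linear_combination -h
  have hns := (Affine.equation_iff_nonsingular_of_Δ_ne_zero hΔ).mp heq
  rw [Affine.nonsingular_iff] at hns
  simp only [b₂, b₄] at h'
  rcases hns.2 with h1 | h1
  · apply h1
    field_simp at h' ⊢
    apply mul_left_cancel₀ h4
    linear_combination -h'
  · apply h1
    field_simp
    ring

/-- The upper bound in Hasse's theorem for elliptic curves over a prime field of odd
characteristic. -/
theorem card_point_le (hq2 : q ≠ 2) (hΔ : W.Δ ≠ 0) :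
    Finite W.toAffine.Point ∧ (Nat.card W.toAffine.Point : ℝ) ≤ (√(q : ℝ) + 1) ^ 2 := by
  obtain ⟨m, hm⟩ := (Fact.out : q.Prime).odd_of_ne_two hq2
  have h2 := two_ne_zero_of_eq hm
  have hinj := toFiber_injective W h2
  refine ⟨Finite.of_injective _ hinj, ?_⟩
  have hcard := Nat.card_le_card_of_injective _ hinj
  set S := ∑ x, (fiber (W.b₂ / 4) (W.b₄ / 2) (W.b₆ / 4) x).card with hS
  have hS' : Nat.card (Option (Σ x, fiber (W.b₂ / 4) (W.b₄ / 2) (W.b₆ / 4) x)) = S + 1 := by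
    simp [hS]
  rw [hS'] at hcard
  have hcard' : (Nat.card W.toAffine.Point : ℝ) ≤ S + 1 := by exact_mod_cast hcard
  refine hcard'.trans ?_
  have hsq : √(q : ℝ) ^ 2 = q := Real.sq_sqrt (Nat.cast_nonneg q)
  have hpos := Real.sqrt_nonneg (q : ℝ)
  rcases le_total q S with hle | hle
  · have h := card_affine_points_le hq2 (cubic_separable h2 hΔ) hle
    rw [← hS] at h
    have h' : ((S : ℝ) - q) ^ 2 ≤ 4 * q := by
      rw [← Nat.cast_sub hle]
      exact_mod_cast h
    have h'' : (S : ℝ) - q ≤ 2 * √(q : ℝ) := by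
      apply le_of_sq_le_sq _ (by positivity)
      rw [mul_pow, hsq]
      linarith
    linarith
  · have : (S : ℝ) ≤ q := by exact_mod_cast hle
    linarith

end Frobenius

/-! ### Recovering `x(P + Q)` from `x(P)`, `x(Q)` and `x(P - Q)` -/

section Cross

variable {F : Type*} [Field F] {W : WeierstrassCurve F}

lemma IsXRep.of_mul_eq_mul {P : W.toAffine.Point} {a b a' b' : F} (h : IsXRep P a b)
    (h' : a' ≠ 0 ∨ b' ≠ 0) (hc : a' * b = a * b') : IsXRep P a' b' := by
  have key : ∃ u : F, u ≠ 0 ∧ a' = u * a ∧ b' = u * b := by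
    by_cases hb : b = 0
    · have ha : a ≠ 0 := h.ne_zero.resolve_right (not_not.mpr hb)
      rw [hb, mul_zero, zero_eq_mul] at hc
      have hb' := hc.resolve_left ha
      have ha' := h'.resolve_right (not_not.mpr hb')
      exact ⟨a' / a, div_ne_zero ha' ha, by field_simp, by simp [hb, hb']⟩
    · have hb' : b' ≠ 0 := by
        rintro rfl
        rw [mul_zero, mul_eq_zero] at hc
        exact h'.elim (fun ha ↦ (hc.resolve_right hb |> ha).elim) (fun h ↦ h rfl)
      exact ⟨b' / b, div_ne_zero hb' hb, by field_simp; linear_combination hc, by field_simp⟩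
  obtain ⟨u, hu, rfl, rfl⟩ := key
  exact h.smul hu

lemma IsXRep.mul_eq_mul {P : W.toAffine.Point} {a b a' b' : F} (h : IsXRep P a b)
    (h' : IsXRep P a' b') : a' * b = a * b' := by
  obtain ⟨u, -, rfl, rfl⟩ := h.eq_smul h'
  ring

lemma isXRep_xRep (P : W.toAffine.Point) : IsXRep P (P.xRep 0) (P.xRep 1) :=
  ⟨1, one_ne_zero, by simp, by simp⟩

variable [DecidableEq F]

/-- On an elliptic curve, the `x`-coordinates of `P`, `Q` and `P - Q` determine that of
`P + Q`. -/
lemma IsXRep.add_of_cross (hΔ : W.Δ ≠ 0) {P Q : W.toAffine.Point} {a₁ b₁ a₂ b₂ c d e f : F}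
    (hP : IsXRep P a₁ b₁) (hQ : IsXRep Q a₂ b₂) (hd : IsXRep (P - Q) e f)
    (hcd : c ≠ 0 ∨ d ≠ 0)
    (h₁ : diffSq a₁ b₁ a₂ b₂ * (c * f + d * e) = sumForm W a₁ b₁ a₂ b₂ * (d * f))
    (h₂ : sumForm W a₁ b₁ a₂ b₂ * (c * e) = prodForm W a₁ b₁ a₂ b₂ * (c * f + d * e)) :
    IsXRep (P + Q) c d := by
  have hs := isXRep_xRep (P + Q)
  obtain ⟨r, hU, hV, hW⟩ := hP.exists_add_sub hQ hs hd
  have hr : r ≠ 0 := by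
    rintro rfl
    exact forms_ne_zero hΔ hP.ne_zero hQ.ne_zero ⟨by simpa using hU, by simpa using hV,
      by simpa using hW⟩
  apply hs.of_mul_eq_mul hcd
  rw [hU, hV] at h₁
  rw [hV, hW] at h₂
  -- One root of the quadratic is known. Whichever of its coordinates is nonzero selects the
  -- relation that determines the other root.
  rcases hd.ne_zero with he | hf
  · apply mul_left_cancel₀ (mul_ne_zero hr (pow_ne_zero 2 he))
    linear_combination h₂
  · apply mul_left_cancel₀ (mul_ne_zero hr (pow_ne_zero 2 hf))
    linear_combination h₁

end Cross

/-! ### Reduction modulo a prime of good reduction -/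

section Reduction

variable {E : WeierstrassCurve ℤ}

/-- The affine rational points of a curve with integer coefficients. -/
abbrev AffinePoint (E : WeierstrassCurve ℤ) : Type :=
  (E.map (Int.castRingHom ℚ)).toAffine.Point

/-- `A` and `B` are homogeneous coordinates of the `x`-coordinate of `P` and are not both divisible
by `q`. -/
def IsIntRep (q : ℕ) (P : AffinePoint E) (A B : ℤ) : Prop :=
  ¬((q : ℤ) ∣ A ∧ (q : ℤ) ∣ B) ∧ IsXRep P (A : ℚ) (B : ℚ)

variable {q : ℕ}

lemma exists_isIntRep (hq : q.Prime) (P : AffinePoint E) : ∃ A B : ℤ, IsIntRep q P A B := by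
  have hq' : Prime (q : ℤ) := Nat.prime_iff_prime_int.mp hq
  rcases P with _ | ⟨x, y, h⟩
  · refine ⟨1, 0, fun h ↦ hq'.not_isUnit (isUnit_of_dvd_one h.1), ?_⟩
    rw [← Affine.Point.zero_def, isXRep_zero_iff]
    simp
  · refine ⟨x.num, x.den, fun h ↦ hq'.not_isUnit (x.isCoprime_num_den.isUnit_of_dvd' h.1 h.2), ?_⟩
    rw [isXRep_some_iff]
    exact ⟨by simp, by simp [Rat.mul_den_eq_num]⟩

lemma IsIntRep.mul_eq_mul {P : AffinePoint E} {A B A' B' : ℤ} (h : IsIntRep q P A B)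
    (h' : IsIntRep q P A' B') : A' * B = A * B' := by
  exact_mod_cast h.2.mul_eq_mul h'.2

/-- The scalar in Vieta's relations is rational and may involve `q`. Cross multiplication eliminates
it, leaving integer identities that can be read modulo `q` or `q^k`. -/
lemma IsIntRep.cross {P Q : AffinePoint E} {a₁ b₁ a₂ b₂ c d e f : ℤ}
    (hP : IsIntRep q P a₁ b₁) (hQ : IsIntRep q Q a₂ b₂) (hs : IsIntRep q (P + Q) c d)
    (hd : IsIntRep q (P - Q) e f) :
    diffSq a₁ b₁ a₂ b₂ * (c * f + d * e) = sumForm E a₁ b₁ a₂ b₂ * (d * f) ∧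
    sumForm E a₁ b₁ a₂ b₂ * (c * e) = prodForm E a₁ b₁ a₂ b₂ * (c * f + d * e) := by
  obtain ⟨r, hU, hV, hW⟩ := hP.2.exists_add_sub hQ.2 hs.2 hd.2
  have cast (n : ℤ) : (n : ℚ) = Int.castRingHom ℚ n := rfl
  simp only [cast] at hU hV hW
  rw [← map_diffSq] at hU
  rw [← map_sumForm] at hV
  rw [← map_prodForm] at hW
  constructor
  · apply (Int.castRingHom ℚ).injective_int
    simp only [map_mul, map_add] at hU hV ⊢
    rw [hU, hV]
    ring
  · apply (Int.castRingHom ℚ).injective_int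
    simp only [map_mul, map_add] at hV hW ⊢
    rw [hV, hW]
    ring

lemma not_dvd_and_iff [Fact q.Prime] {A B : ℤ} :
    ¬((q : ℤ) ∣ A ∧ (q : ℤ) ∣ B) ↔ (A : ZMod q) ≠ 0 ∨ (B : ZMod q) ≠ 0 := by
  rw [ne_eq, ne_eq, ZMod.intCast_zmod_eq_zero_iff_dvd, ZMod.intCast_zmod_eq_zero_iff_dvd]
  tauto

/-- If the `x`-coordinate of `P` reduces to that of `P'`, then the `x`-coordinates of the multiples
of `P` reduce to those of the multiples of `P'`. -/
lemma IsIntRep.isXRep_nsmul [Fact q.Prime]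
    (hΔ : (E.map (Int.castRingHom (ZMod q))).Δ ≠ 0) {P : AffinePoint E}
    {P' : (E.map (Int.castRingHom (ZMod q))).toAffine.Point} {A₁ B₁ : ℤ}
    (hP : IsIntRep q P A₁ B₁) (hP' : IsXRep P' (A₁ : ZMod q) (B₁ : ZMod q)) (n : ℕ) :
    ∀ A B : ℤ, IsIntRep q (n • P) A B → IsXRep (n • P') (A : ZMod q) (B : ZMod q) := by
  have hq : q.Prime := Fact.out
  induction n using Nat.twoStepInduction with
  | zero =>
    intro A B h
    have h2 := h.2
    rw [zero_nsmul, isXRep_zero_iff] at h2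
    have hB : B = 0 := by exact_mod_cast h2.2
    have h1 := not_dvd_and_iff.mp h.1
    rw [zero_nsmul, isXRep_zero_iff]
    simpa [hB] using h1
  | one =>
    intro A B h
    rw [one_nsmul] at h ⊢
    refine hP'.of_mul_eq_mul (not_dvd_and_iff.mp h.1) ?_
    exact_mod_cast congrArg (Int.cast (R := ZMod q)) (hP.mul_eq_mul h)
  | more n ih₀ ih₁ =>
    intro A B h
    obtain ⟨e, f, hef⟩ := exists_isIntRep hq (n • P)
    obtain ⟨a, b, hab⟩ := exists_isIntRep hq ((n + 1) • P)
    have hs : (n + 2) • P = (n + 1) • P + P := by module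
    have hd : n • P = (n + 1) • P - P := by module
    have hs' : (n + 2) • P' = (n + 1) • P' + P' := by module
    have hd' : n • P' = (n + 1) • P' - P' := by module
    have hef' := ih₀ e f hef
    rw [hd'] at hef'
    rw [hs] at h
    rw [hd] at hef
    obtain ⟨h₁, h₂⟩ := hab.cross hP h hef
    rw [hs']
    apply (ih₁ a b hab).add_of_cross hΔ hP' hef' (not_dvd_and_iff.mp h.1)
    · have := congrArg (Int.castRingHom (ZMod q)) h₁
      rw [map_mul, map_diffSq, map_mul, map_sumForm] at this
      simpa only [map_mul, map_add, eq_intCast] using this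
    · have := congrArg (Int.castRingHom (ZMod q)) h₂
      rw [map_mul, map_sumForm, map_mul, map_mul, map_prodForm] at this
      simpa only [map_mul, map_add, eq_intCast] using this

/-- The affine point attached to a projective point. -/
noncomputable def affine (P : RatPoint E) : AffinePoint E :=
  WeierstrassCurve.Projective.Point.toAffineAddEquiv (E.map (Int.castRingHom ℚ)).toProjective P

lemma affine_nsmul (n : ℕ) (P : RatPoint E) : affine (n • P) = n • affine P :=
  map_nsmul (WeierstrassCurve.Projective.Point.toAffineAddEquiv _) n P

lemma IsPrimitiveRep.nonsingular {P : RatPoint E} {x y z : ℤ} (h : IsPrimitiveRep P x y z) :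
    Projective.Nonsingular (E.map (Int.castRingHom ℚ)).toProjective ![(x : ℚ), y, z] := by
  have := P.nonsingular
  rw [h.2] at this
  exact this

lemma IsPrimitiveRep.affine_of_ne_zero {P : RatPoint E} {x y z : ℤ} (h : IsPrimitiveRep P x y z)
    (hz : z ≠ 0) : ∃ h' : (E.map (Int.castRingHom ℚ)).toAffine.Nonsingular (x / z) (y / z),
      affine P = .some _ _ h' := by
  obtain ⟨hP⟩ := P
  have h2 : _ = _ := h.2
  have hz' : ![(x : ℚ), y, z] 2 ≠ 0 := by simpa using hz
  subst h2
  exact ⟨_, Projective.Point.toAffineLift_of_Z_ne_zero (hP := hP) hz'⟩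

lemma IsPrimitiveRep.affine_of_eq_zero {P : RatPoint E} {x y z : ℤ} (h : IsPrimitiveRep P x y z)
    (hz : z = 0) : affine P = 0 := by
  obtain ⟨hP⟩ := P
  have h2 : _ = _ := h.2
  have hz' : ![(x : ℚ), y, z] 2 = 0 := by simpa using hz
  subst h2
  exact Projective.Point.toAffineLift_of_Z_eq_zero hP hz'

lemma IsPrimitiveRep.equation {P : RatPoint E} {x y z : ℤ} (h : IsPrimitiveRep P x y z) :
    y ^ 2 * z + E.a₁ * x * y * z + E.a₃ * y * z ^ 2 =
      x ^ 3 + E.a₂ * x ^ 2 * z + E.a₄ * x * z ^ 2 + E.a₆ * z ^ 3 := by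
  have h' := h.nonsingular.1
  rw [Projective.equation_iff] at h'
  simp at h'
  apply sub_eq_zero.mp
  exact_mod_cast h'

lemma IsPrimitiveRep.not_dvd (hq : q.Prime) {P : RatPoint E} {x y z : ℤ}
    (h : IsPrimitiveRep P x y z) : ¬((q : ℤ) ∣ x ∧ (q : ℤ) ∣ y ∧ (q : ℤ) ∣ z) := by
  rintro ⟨hx, hy, hz⟩
  have h1 := Int.dvd_coe_gcd hx (Int.dvd_coe_gcd hy hz)
  rw [h.1] at h1
  exact (Nat.prime_iff_prime_int.mp hq).not_isUnit (isUnit_of_dvd_one (by exact_mod_cast h1))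

lemma IsPrimitiveRep.isIntRep_of_not_dvd {P : RatPoint E} {x y z : ℤ}
    (h : IsPrimitiveRep P x y z) (hz : ¬(q : ℤ) ∣ z) : IsIntRep q (affine P) x z := by
  have hz0 : z ≠ 0 := by rintro rfl; simp at hz
  obtain ⟨h', e⟩ := h.affine_of_ne_zero hz0
  have hz' : (z : ℚ) ≠ 0 := by exact_mod_cast hz0
  refine ⟨fun h ↦ hz h.2, ?_⟩
  rw [e, isXRep_some_iff]
  exact ⟨hz', by field_simp⟩

/-- Near the identity, the `x`-coordinate has homogeneous coordinates `(R, x ^ 2)` where `R` is a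
unit and `z * R = x ^ 3`. -/
lemma IsPrimitiveRep.exists_isIntRep_of_dvd (hq : q.Prime) {P : RatPoint E} {x y z : ℤ}
    (h : IsPrimitiveRep P x y z) (hz : (q : ℤ) ∣ z) : (q : ℤ) ∣ x ∧
      ∃ R : ℤ, ¬(q : ℤ) ∣ R ∧ z * R = x ^ 3 ∧ IsIntRep q (affine P) R (x ^ 2) := by
  have hq' : Prime (q : ℤ) := Nat.prime_iff_prime_int.mp hq
  have heq := h.equation
  set R := y ^ 2 + E.a₁ * x * y + E.a₃ * y * z - (E.a₂ * x ^ 2 + E.a₄ * x * z + E.a₆ * z ^ 2)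
    with hR
  have hzR : z * R = x ^ 3 := by rw [hR]; linear_combination heq
  have hx : (q : ℤ) ∣ x := hq'.dvd_of_dvd_pow (hzR ▸ hz.mul_right R)
  have hy : ¬(q : ℤ) ∣ y := fun hy ↦ h.not_dvd hq ⟨hx, hy, hz⟩
  have hRq : ¬(q : ℤ) ∣ R := by
    intro hd
    apply hy
    apply hq'.dvd_of_dvd_pow (n := 2)
    obtain ⟨u, hu⟩ := hd
    obtain ⟨v, hv⟩ := hx
    obtain ⟨w, hw⟩ := hz
    refine ⟨u - E.a₁ * v * y - E.a₃ * y * w + E.a₂ * x * v + E.a₄ * v * z + E.a₆ * z * w, ?_⟩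
    linear_combination hu - hR - E.a₁ * y * hv - E.a₃ * y * hw + E.a₂ * x * hv + E.a₄ * z * hv +
      E.a₆ * z * hw
  refine ⟨hx, R, hRq, hzR, fun h ↦ hRq h.1, ?_⟩
  have hR0 : R ≠ 0 := by rintro h0; rw [h0] at hRq; simp at hRq
  by_cases hz0 : z = 0
  · have hx0 : x = 0 := by
      rw [hz0, zero_mul] at hzR
      exact pow_eq_zero_iff three_ne_zero |>.mp hzR.symm
    rw [h.affine_of_eq_zero hz0, isXRep_zero_iff]
    exact ⟨by exact_mod_cast hR0, by simp [hx0]⟩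
  · obtain ⟨h', e⟩ := h.affine_of_ne_zero hz0
    have hz' : (z : ℚ) ≠ 0 := by exact_mod_cast hz0
    have hx0 : (x : ℚ) ≠ 0 := by
      intro hx0
      have : x = 0 := by exact_mod_cast hx0
      rw [this] at hzR
      exact mul_ne_zero hz0 hR0 (by simpa using hzR)
    have hzR' : (z : ℚ) * R = x ^ 3 := by exact_mod_cast hzR
    rw [e, isXRep_some_iff]
    push_cast
    refine ⟨pow_ne_zero 2 hx0, ?_⟩
    field_simp
    linear_combination hzR'

lemma IsPrimitiveRep.dvd_iff (hq : q.Prime) {P : RatPoint E} {x y z A B : ℤ}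
    (h : IsPrimitiveRep P x y z) (hAB : IsIntRep q (affine P) A B) :
    (q : ℤ) ∣ z ↔ (q : ℤ) ∣ B := by
  have hq' : Prime (q : ℤ) := Nat.prime_iff_prime_int.mp hq
  by_cases hz : (q : ℤ) ∣ z
  · obtain ⟨hx, R, hR, -, hrep⟩ := h.exists_isIntRep_of_dvd hq hz
    have he := hAB.mul_eq_mul hrep
    simp only [hz, true_iff]
    refine (hq'.dvd_or_dvd (he ▸ ?_)).resolve_left hR
    exact (dvd_pow hx two_ne_zero).mul_left A
  · have he := hAB.mul_eq_mul (h.isIntRep_of_not_dvd hz)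
    simp only [hz, false_iff]
    intro hB
    exact hAB.1 ⟨(hq'.dvd_or_dvd (he ▸ hB.mul_left x)).resolve_right hz, hB⟩

lemma exists_reduction_aux [Fact q.Prime]
    (hΔ : (E.map (Int.castRingHom (ZMod q))).Δ ≠ 0) (P : RatPoint E) :
    ∃ (A B : ℤ) (P' : (E.map (Int.castRingHom (ZMod q))).toAffine.Point),
      IsIntRep q (affine P) A B ∧ IsXRep P' (A : ZMod q) (B : ZMod q) := by
  have hq : q.Prime := Fact.out
  obtain ⟨x, y, z, h⟩ := exists_isPrimitiveRep P
  by_cases hz : (q : ℤ) ∣ z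
  · obtain ⟨hx, R, hR, -, hrep⟩ := h.exists_isIntRep_of_dvd hq hz
    refine ⟨R, x ^ 2, 0, hrep, ?_⟩
    rw [isXRep_zero_iff, ne_eq, ZMod.intCast_zmod_eq_zero_iff_dvd,
      ZMod.intCast_zmod_eq_zero_iff_dvd]
    exact ⟨hR, dvd_pow hx two_ne_zero⟩
  · have hz' : (z : ZMod q) ≠ 0 := by rwa [ne_eq, ZMod.intCast_zmod_eq_zero_iff_dvd]
    have heq : (E.map (Int.castRingHom (ZMod q))).toAffine.Equation (x / z) (y / z) := by
      have := congrArg (Int.cast (R := ZMod q)) h.equation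
      push_cast at this
      rw [Affine.equation_iff]
      simp only [map_a₁, map_a₂, map_a₃, map_a₄, map_a₆, eq_intCast]
      field_simp
      linear_combination this
    refine ⟨x, z, .some _ _ ((Affine.equation_iff_nonsingular_of_Δ_ne_zero hΔ).mp heq),
      h.isIntRep_of_not_dvd hz, ?_⟩
    rw [isXRep_some_iff]
    exact ⟨hz', by field_simp⟩

/-- At a prime of good reduction, every rational point has a reduction such that a multiple of the
point is zero modulo the prime if and only if the same multiple of the reduction is zero. -/
theorem exists_reduction [Fact q.Prime]
    (hΔ : (E.map (Int.castRingHom (ZMod q))).Δ ≠ 0) (P : RatPoint E) :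
    ∃ P' : (E.map (Int.castRingHom (ZMod q))).toAffine.Point,
      ∀ n : ℕ, IsZeroMod (n • P) (q : ℤ) ↔ n • P' = 0 := by
  have hq : q.Prime := Fact.out
  obtain ⟨A₁, B₁, P', hrep, hrep'⟩ := exists_reduction_aux hΔ P
  refine ⟨P', fun n ↦ ?_⟩
  obtain ⟨x, y, z, h⟩ := exists_isPrimitiveRep (n • P)
  obtain ⟨A, B, hAB⟩ := exists_isIntRep hq (affine (n • P))
  rw [h.isZeroMod_iff, h.dvd_iff hq hAB]
  rw [affine_nsmul] at hAB
  rw [(hrep.isXRep_nsmul hΔ hrep' n A B hAB).eq_zero_iff, ZMod.intCast_zmod_eq_zero_iff_dvd]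

end Reduction

/-! ### Points near the identity -/

section FormalGroup

variable {E : WeierstrassCurve ℤ} {q : ℕ}

/-- The addition step for the parameter `b / a` of points near the identity, modulo its square. -/
lemma mul_eq_of_sumForm_eq {R : Type*} [CommRing R] {W : WeierstrassCurve R}
    {a₁ b₁ a₂ b₂ c d e f n : R} (ha₁ : IsUnit a₁) (ha₂ : IsUnit a₂) (he : IsUnit e)
    (hb : b₂ ^ 2 = 0) (h₁ : b₁ * a₂ = (n + 1) ^ 2 * b₂ * a₁) (h₀ : f * a₂ = n ^ 2 * b₂ * e)
    (h : sumForm W a₁ b₁ a₂ b₂ * (c * e) = prodForm W a₁ b₁ a₂ b₂ * (c * f + d * e)) :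
    d * a₂ = (n + 2) ^ 2 * b₂ * c := by
  have hbb : b₁ * b₂ = 0 := by
    apply ha₂.mul_right_cancel
    linear_combination b₂ * h₁ + (n + 1) ^ 2 * a₁ * hb
  have hV : sumForm W a₁ b₁ a₂ b₂ = 2 * (a₁ * a₂) * (a₁ * b₂ + a₂ * b₁) := by
    rw [sumForm, hbb]; ring
  have hW : prodForm W a₁ b₁ a₂ b₂ = (a₁ * a₂) ^ 2 := by
    rw [prodForm, hbb]; ring
  rw [hV, hW] at h
  -- In the parameter `b / a` this is the parallelogram law, and `(n + 2)² = 2(n + 1)² + 2 - n²`.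
  have h' : 2 * (a₁ * b₂ + a₂ * b₁) * (c * e) = a₁ * a₂ * (c * f + d * e) := by
    apply (ha₁.mul ha₂).mul_left_cancel
    linear_combination h
  apply (ha₁.mul he).mul_left_cancel
  linear_combination -h' + 2 * c * e * h₁ - a₁ * c * h₀

lemma isUnit_intCast_zmod_pow (hq : q.Prime) {a : ℤ} (ha : ¬(q : ℤ) ∣ a) (k : ℕ) :
    IsUnit (a : ZMod (q ^ k)) := by
  rw [ZMod.coe_int_isUnit_iff_isCoprime]
  push_cast
  exact ((Nat.prime_iff_prime_int.mp hq).coprime_iff_not_dvd.mpr ha).pow_left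

/-- The inverse of the `x`-coordinate vanishes to second order at the identity, so multiplication by
`n` scales it by `n²` to leading order; the curve's coefficients enter only through terms divisible
by `B₁²`. -/
lemma IsIntRep.nsmul_near_zero (hq : q.Prime) {P : AffinePoint E} {A₁ B₁ : ℤ} {k : ℕ}
    (hP : IsIntRep q P A₁ B₁) (hk : k ≠ 0) (hB : (q : ℤ) ∣ B₁) (hB2 : (q ^ k : ℤ) ∣ B₁ ^ 2)
    (n : ℕ) : ∀ A B : ℤ, IsIntRep q (n • P) A B →
      ¬(q : ℤ) ∣ A ∧ (q ^ k : ℤ) ∣ B * A₁ - n ^ 2 * B₁ * A := by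
  have hq' : Prime (q : ℤ) := Nat.prime_iff_prime_int.mp hq
  have hA₁ : ¬(q : ℤ) ∣ A₁ := fun h ↦ hP.1 ⟨h, hB⟩
  have hqk : (q : ℤ) ∣ (q ^ k : ℤ) := dvd_pow_self _ hk
  have hA (n : ℕ) {A B : ℤ} (h : IsIntRep q (n • P) A B)
      (hd : (q ^ k : ℤ) ∣ B * A₁ - n ^ 2 * B₁ * A) : ¬(q : ℤ) ∣ A := by
    intro hA
    have h1 : (q : ℤ) ∣ B * A₁ := by
      have := (hqk.trans hd).add ((hB.mul_left (n ^ 2)).mul_right A)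
      simpa using this
    exact h.1 ⟨hA, (hq'.dvd_or_dvd h1).resolve_right hA₁⟩
  have hcast (x : ℤ) : (q ^ k : ℤ) ∣ x ↔ (x : ZMod (q ^ k)) = 0 := by
    rw [ZMod.intCast_zmod_eq_zero_iff_dvd]
    push_cast
    rfl
  induction n using Nat.twoStepInduction with
  | zero =>
    intro A B h
    have h2 := h.2
    rw [zero_nsmul, isXRep_zero_iff] at h2
    have hB0 : B = 0 := by exact_mod_cast h2.2
    have hd : (q ^ k : ℤ) ∣ B * A₁ - (0 : ℕ) ^ 2 * B₁ * A := by simp [hB0]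
    exact ⟨hA 0 h hd, hd⟩
  | one =>
    intro A B h
    have hd : (q ^ k : ℤ) ∣ B * A₁ - (1 : ℕ) ^ 2 * B₁ * A := by
      rw [one_nsmul] at h
      have := hP.mul_eq_mul h
      rw [show B * A₁ - (1 : ℕ) ^ 2 * B₁ * A = 0 by push_cast; linear_combination -this]
      exact dvd_zero _
    exact ⟨hA 1 h hd, hd⟩
  | more n ih₀ ih₁ =>
    intro A B h
    suffices hd : (q ^ k : ℤ) ∣ B * A₁ - (n + 2 : ℕ) ^ 2 * B₁ * A from ⟨hA (n + 2) h hd, hd⟩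
    obtain ⟨e, f, hef⟩ := exists_isIntRep hq (n • P)
    obtain ⟨a, b, hab⟩ := exists_isIntRep hq ((n + 1) • P)
    obtain ⟨he, hf⟩ := ih₀ e f hef
    obtain ⟨ha, hb⟩ := ih₁ a b hab
    have hs : (n + 2) • P = (n + 1) • P + P := by module
    have hd : n • P = (n + 1) • P - P := by module
    rw [hs] at h
    rw [hd] at hef
    have h₂ := congrArg (Int.castRingHom (ZMod (q ^ k))) (hab.cross hP h hef).2
    rw [map_mul, map_sumForm, map_mul, map_mul, map_prodForm] at h₂
    simp only [map_mul, map_add, eq_intCast] at h₂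
    rw [hcast] at hf hb hB2 ⊢
    push_cast at hf hb hB2 ⊢
    rw [sub_eq_zero] at hf hb ⊢
    exact mul_eq_of_sumForm_eq (isUnit_intCast_zmod_pow hq ha k)
      (isUnit_intCast_zmod_pow hq hA₁ k) (isUnit_intCast_zmod_pow hq he k) hB2 hb hf h₂

/-- In the kernel of reduction modulo `q`, multiplication by an integer prime to `q` does not change
the power of `q` modulo which a point is zero. -/
theorem IsPrimitiveRep.pow_dvd_of_nsmul (hq : q.Prime) {p : ℕ} (hp : ¬q ∣ p) {P : RatPoint E}
    {x y z x' y' z' : ℤ} (h : IsPrimitiveRep P x y z) (h' : IsPrimitiveRep (p • P) x' y' z')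
    (hz : (q : ℤ) ∣ z) {k : ℕ} (hk : (q ^ k : ℤ) ∣ z') : (q ^ k : ℤ) ∣ z := by
  have hq' : Prime (q : ℤ) := Nat.prime_iff_prime_int.mp hq
  rcases Nat.eq_zero_or_pos k with rfl | hkpos
  · simp
  obtain ⟨hx, R, hR, hzR, hrep⟩ := h.exists_isIntRep_of_dvd hq hz
  obtain ⟨hx', R', hR', hzR', hrep'⟩ :=
    h'.exists_isIntRep_of_dvd hq ((dvd_pow_self _ hkpos.ne').trans hk)
  have hcop : IsCoprime ((q : ℤ) ^ k) R := (hq'.coprime_iff_not_dvd.mpr hR).pow_left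
  refine hcop.dvd_of_dvd_mul_right ?_
  rw [hzR]
  by_cases hx0 : x = 0
  · simp [hx0]
  obtain ⟨m, x₀, hx₀, rfl⟩ : ∃ (m : ℕ) (x₀ : ℤ), ¬(q : ℤ) ∣ x₀ ∧ x = q ^ m * x₀ :=
    (FiniteMultiplicity.of_prime_left hq' hx0).exists_eq_pow_mul_and_not_dvd.elim
      fun x₀ h ↦ ⟨_, x₀, h.2, h.1⟩
  have hm : m ≠ 0 := by
    rintro rfl
    simp [hx₀] at hx
  rw [affine_nsmul] at hrep'
  -- Here `B₁ = x²` has valuation `2m`. The modulus `q^(2m+1)` just captures its leading term and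
  -- divides `B₁²`, since `m ≥ 1`.
  have hdvd := (hrep.nsmul_near_zero hq (k := 2 * m + 1) (by omega) (dvd_pow hx two_ne_zero)
    (by
      rw [mul_pow, mul_pow, ← pow_mul, ← pow_mul]
      exact (pow_dvd_pow _ (by omega)).mul_right _) p _ _ hrep').2
  -- Otherwise `x'²` would vanish modulo `q^(2m+1)`, whereas `p² x² R'` has valuation exactly `2m`.
  have hxm : ¬(q : ℤ) ^ (m + 1) ∣ x' := by
    intro hd
    have h1 : (q : ℤ) ^ (2 * m + 1) ∣ x' ^ 2 := by
      refine dvd_trans ?_ (pow_dvd_pow_of_dvd hd 2)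
      rw [← pow_mul]
      exact pow_dvd_pow _ (by omega)
    have h2 : (q : ℤ) ^ (2 * m + 1) ∣ q ^ (2 * m) * (p ^ 2 * x₀ ^ 2 * R') := by
      have := (h1.mul_right R).sub hdvd
      refine this.trans (dvd_of_eq ?_)
      ring
    rw [pow_succ] at h2
    have h3 := Int.dvd_of_mul_dvd_mul_left (pow_ne_zero _ hq'.ne_zero) h2
    rcases hq'.dvd_or_dvd h3 with h4 | h4
    · rcases hq'.dvd_or_dvd h4 with h5 | h5
      · exact hp (by exact_mod_cast hq'.dvd_of_dvd_pow h5)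
      · exact hx₀ (hq'.dvd_of_dvd_pow h5)
    · exact hR' h4
  have hx3 : (q : ℤ) ^ k ∣ x' ^ 3 := hzR' ▸ hk.mul_right R'
  -- From `z' R' = x'³` and the bound `m` on the valuation of `x'`; the valuation of `x³ = z R` is
  -- at least `3m`.
  have hkm : k ≤ 3 * m := by
    have hx0' : x' ≠ 0 := by rintro rfl; simp at hxm
    obtain ⟨m', x₁, hx₁, rfl⟩ : ∃ (m' : ℕ) (x₁ : ℤ), ¬(q : ℤ) ∣ x₁ ∧ x' = q ^ m' * x₁ :=
      (FiniteMultiplicity.of_prime_left hq' hx0').exists_eq_pow_mul_and_not_dvd.elim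
        fun x₀ h ↦ ⟨_, x₀, h.2, h.1⟩
    have hm' : m' ≤ m := by
      by_contra! hlt
      exact hxm ((pow_dvd_pow _ hlt).mul_right _)
    have hc : IsCoprime ((q : ℤ) ^ k) (x₁ ^ 3) := (hq'.coprime_iff_not_dvd.mpr hx₁).pow
    rw [mul_pow, ← pow_mul] at hx3
    have h5 := hc.dvd_of_dvd_mul_right hx3
    rw [pow_dvd_pow_iff hq'.ne_zero hq'.not_isUnit] at h5
    omega
  rw [mul_pow, ← pow_mul]
  exact (pow_dvd_pow _ (by omega)).mul_right _

end FormalGroup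

/-! ### The order of the reduced point and the primality criterion -/

section Main

/-- A point of exact order `p ^ b` modulo an odd prime of good reduction bounds `p ^ b`. -/
theorem pow_le_of_isZeroMod {E : WeierstrassCurve ℤ} {q : ℕ} (hq : q.Prime) (hq2 : q ≠ 2)
    (hΔ : ¬(q : ℤ) ∣ E.Δ) {p : ℕ} (hp : p.Prime) {P : RatPoint E} {b : ℕ}
    (hzero : IsZeroMod (p ^ (b + 1) • P) (q : ℤ)) (hnonzero : IsNonzeroMod (p ^ b • P) (q : ℤ)) :
    ((p : ℝ) ^ (b + 1)) ≤ (√(q : ℝ) + 1) ^ 2 := by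
  have : Fact q.Prime := ⟨hq⟩
  have : Fact p.Prime := ⟨hp⟩
  have hΔ' : (E.map (Int.castRingHom (ZMod q))).Δ ≠ 0 := by
    rwa [map_Δ, eq_intCast, ne_eq, ZMod.intCast_zmod_eq_zero_iff_dvd]
  obtain ⟨P', hP'⟩ := exists_reduction hΔ' P
  have hord : addOrderOf P' = p ^ (b + 1) := by
    apply addOrderOf_eq_prime_pow
    · rw [← hP']
      exact hnonzero
    · rw [← hP']
      exact hzero
  obtain ⟨hfin, hcard⟩ := card_point_le (E.map (Int.castRingHom (ZMod q))) hq2 hΔ'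
  have hle : p ^ (b + 1) ≤ Nat.card (E.map (Int.castRingHom (ZMod q))).toAffine.Point := by
    rw [← hord]
    exact Nat.le_of_dvd Nat.card_pos (addOrderOf_dvd_natCard P')
  refine le_trans ?_ hcard
  exact_mod_cast hle

end Main

end PrimeTest

theorem mainTheorem2 (E : WeierstrassCurve ℤ) [(E.map (Int.castRingHom ℚ)).IsElliptic]
    (p : ℕ) (hp : p.Prime) (N : ℕ) (hN : Odd N) (hcop : IsCoprime (N : ℤ) ((p : ℤ) * E.Δ))
    (P : PrimeTest.RatPoint E) (b : ℕ) (hb : 0 < b)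
    (hbound : (p : ℝ) ^ b > (Real.sqrt ((N : ℝ) / 3) + 1) ^ 2)
    (hzero : PrimeTest.IsZeroMod (p ^ b • P) (N : ℤ))
    (hnonzero : PrimeTest.IsNonzeroMod (p ^ (b - 1) • P) (N : ℤ)) :
    N.Prime := by
  obtain ⟨b, rfl⟩ : ∃ b', b = b' + 1 := ⟨b - 1, by omega⟩
  rw [Nat.add_sub_cancel] at hnonzero
  obtain ⟨x, y, z, h⟩ := PrimeTest.exists_isPrimitiveRep (p ^ b • P)
  obtain ⟨x', y', z', h'⟩ := PrimeTest.exists_isPrimitiveRep (p ^ (b + 1) • P)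
  have hNz : ¬N ∣ z.natAbs := by
    rw [← Int.natCast_dvd]
    exact fun hd ↦ hnonzero ((h.isZeroMod_iff N).mpr hd)
  have hNz' : (N : ℤ) ∣ z' := (h'.isZeroMod_iff N).mp hzero
  -- Failure of divisibility by `N` is witnessed at one prime power, and its prime is the one at
  -- which to reduce.
  rw [Nat.dvd_iff_prime_pow_dvd_dvd] at hNz
  push Not at hNz
  obtain ⟨q, k, hq, hqN, hqz⟩ := hNz
  have hqz : ¬(q ^ k : ℤ) ∣ z := by
    rw [← Int.natCast_pow, Int.natCast_dvd]
    exact hqz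
  have hk : k ≠ 0 := by
    rintro rfl
    simp at hqz
  have hqdvd : q ∣ N := (dvd_pow_self q hk).trans hqN
  have hq' : Prime (q : ℤ) := Nat.prime_iff_prime_int.mp hq
  have hqdvd' : (q : ℤ) ∣ N := Int.natCast_dvd_natCast.mpr hqdvd
  have hqcop : ¬(q : ℤ) ∣ p * E.Δ := fun hd ↦ hq'.not_isUnit (hcop.isUnit_of_dvd' hqdvd' hd)
  have hqp : ¬q ∣ p := fun hd ↦ hqcop ((Int.natCast_dvd_natCast.mpr hd).mul_right _)
  have hqΔ : ¬(q : ℤ) ∣ E.Δ := fun hd ↦ hqcop (hd.mul_left _)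
  have hq2 : q ≠ 2 := by
    rintro rfl
    exact (Nat.not_even_iff_odd.mpr hN) (even_iff_two_dvd.mpr hqdvd)
  -- Nonvanishing mod `q^k` is upgraded to nonvanishing mod `q`: in the kernel of reduction, `q^k`
  -- dividing `z'` would force `q^k` to divide `z`.
  have hnz : PrimeTest.IsNonzeroMod (p ^ b • P) (q : ℤ) := by
    rw [PrimeTest.IsNonzeroMod, h.isZeroMod_iff]
    intro hd
    rw [pow_succ', mul_smul] at h'
    exact hqz (h.pow_dvd_of_nsmul hq hqp h' hd (dvd_trans (by exact_mod_cast hqN) hNz'))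
  have hz : PrimeTest.IsZeroMod (p ^ (b + 1) • P) (q : ℤ) :=
    (h'.isZeroMod_iff q).mpr (hqdvd'.trans hNz')
  have hle := PrimeTest.pow_le_of_isZeroMod hq hq2 hqΔ hp hz hnz
  -- Otherwise `(√q + 1)²` would be at most `(√(N/3) + 1)²`, against `hbound` and `hle`.
  have hlt : (N : ℝ) / 3 < q := by
    by_contra! hge
    have := Real.sqrt_le_sqrt hge
    have h0 := Real.sqrt_nonneg (q : ℝ)
    nlinarith
  have hlt' : N < 3 * q := by
    have : (N : ℝ) < 3 * q := by linarith
    exact_mod_cast this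
  obtain ⟨t, rfl⟩ := hqdvd
  have ht : Odd t := (Nat.odd_mul.mp hN).2
  have ht3 : t < 3 := by
    rw [mul_comm] at hlt'
    exact Nat.lt_of_mul_lt_mul_right hlt'
  have ht1 : t = 1 := by
    obtain ⟨s, rfl⟩ := ht
    omega
  rwa [ht1, mul_one]
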